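/- For a simple graph $G$ and a set $S\subseteq V(G)$, an $S$-tree of $G$ is a subgraph $T$ of $G$ that is a tree with $S\subseteq V(T)$. Trees $T_1,\dots,T_r$ are internally edge disjoint $S$-trees if each is an $S$-tree and $V(T_i)\cap V(T_j)=S$ and $E(T_i)\cap E(T_j)=\emptyset$ for all $i\neq j$. Let $\kappa_G(S)$ be the maximum number of internally edge disjoint $S$-trees of $G$ and, for $2\le k\le |V(G)|$, let $\kappa_k(G)=\min\{\kappa_G(S) : S\subseteq V(G),\ |S|=k\}$ be the generalized $k$-connectivity of $G$. For $n\ge 3$ let $S_n$ be the symmetric group on $\{1,\dots,n\}$, with $\sigma\tau$ the map $i\mapsto\sigma(\tau(i))$, and let $$\Omega^*=\{(1\,2),(1\,2\,3),(1\,3\,2)\}\cup\{(1\,2)(3\,i) : 4\le i\le n\}.$$ The $n$-dimensional godan graph $EA_n=\mathrm{Cay}(S_n,\Omega^*)$ has vertex set $S_n$, and $u,v$ are adjacent if and only if $u=vs$ for some $s\in\Omega^*$. **Theorem.** For every $n\ge 3$, $\kappa_3(EA_n)=n-1$. -/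

import Mathlib

namespace SimpleGraph

variable {V : Type*} (G : SimpleGraph V)

/-- An `S`-tree of `G`: a subgraph of `G` that is a tree and whose vertex set contains `S`. -/
structure IsSTree (S : Set V) (T : G.Subgraph) : Prop where
  isTree : T.coe.IsTree
  subset_verts : S ⊆ T.verts

/-- `T₁, …, T_r` are internally edge disjoint `S`-trees of `G`: each is an `S`-tree, and two
trees with different indices have exactly the vertices of `S`, and no edge, in common. -/
structure InternallyEdgeDisjointSTrees (S : Set V) {r : ℕ} (T : Fin r → G.Subgraph) : Prop where
  isSTree : ∀ i, G.IsSTree S (T i)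
  verts_inter : ∀ i j, i ≠ j → (T i).verts ∩ (T j).verts = S
  edge_disjoint : ∀ i j, i ≠ j → (T i).edgeSet ∩ (T j).edgeSet = ∅

/-- `κ_G(S)`: the maximum number of internally edge disjoint `S`-trees of `G` (as a supremum in
`ℕ∞`, so that no junk value arises where the number is unbounded). -/
noncomputable def treeConnectivity (S : Set V) : ℕ∞ :=
  ⨆ (r : ℕ) (_ : ∃ T : Fin r → G.Subgraph, G.InternallyEdgeDisjointSTrees S T), (r : ℕ∞)

/-- The generalized `k`-connectivity `κ_k(G)`: the minimum of `κ_G(S)` over all sets `S` of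
exactly `k` vertices of `G`. -/
noncomputable def generalizedConnectivity (k : ℕ) : ℕ∞ :=
  ⨅ (S : Finset V) (_ : S.card = k), G.treeConnectivity (S : Set V)

end SimpleGraph

/-- The generators `(1 2), (1 2 3), (1 3 2)` and `(1 2)(3 i)`, `4 ≤ i ≤ n`, of the godan graph.
The points `1, …, n` are the elements `0, …, n - 1` of `Fin n`; `List.formPerm [a, b, c]` is
the cycle `a ↦ b ↦ c ↦ a`. -/
def godanGenerators (n : ℕ) (hn : 3 ≤ n) : Set (Equiv.Perm (Fin n)) :=
  let p₁ : Fin n := ⟨0, by omega⟩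
  let p₂ : Fin n := ⟨1, by omega⟩
  let p₃ : Fin n := ⟨2, by omega⟩
  {Equiv.swap p₁ p₂, List.formPerm [p₁, p₂, p₃], List.formPerm [p₁, p₃, p₂]} ∪
    {s | ∃ i : Fin n, 3 ≤ (i : ℕ) ∧ s = Equiv.swap p₁ p₂ * Equiv.swap p₃ i}

/-- The `n`-dimensional godan graph `EA_n`: the Cayley graph on the symmetric group of `n` points
with the generators above, `u` and `v` being adjacent when `u = v * s` for a generator `s`
(see `godanGraph_adj`). -/
def godanGraph (n : ℕ) (hn : 3 ≤ n) : SimpleGraph (Equiv.Perm (Fin n)) :=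
  SimpleGraph.mulCayley (godanGenerators n hn)

theorem godanGenerators_inv (n : ℕ) (hn : 3 ≤ n) {s : Equiv.Perm (Fin n)}
    (hs : s ∈ godanGenerators n hn) : s⁻¹ ∈ godanGenerators n hn := by
  rcases hs with (rfl | rfl | rfl) | ⟨i, hi, rfl⟩
  · left; left; simp
  · left; right; right
    rw [← List.formPerm_reverse]
    exact List.formPerm_eq_of_isRotated (by simp) ⟨2, rfl⟩
  · left; right; left
    rw [← List.formPerm_reverse]
    exact List.formPerm_eq_of_isRotated (by simp) ⟨2, rfl⟩
  · right
    refine ⟨i, hi, ?_⟩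
    have hd : Equiv.Perm.Disjoint (Equiv.swap (⟨0, by omega⟩ : Fin n) ⟨1, by omega⟩)
        (Equiv.swap ⟨2, by omega⟩ i) := by
      intro x
      by_cases h0 : x = ⟨2, by omega⟩
      · left; subst h0; apply Equiv.swap_apply_of_ne_of_ne <;> simp
      by_cases h1 : x = i
      · left; subst h1
        apply Equiv.swap_apply_of_ne_of_ne <;> (intro h; simp [h] at hi)
      · right; exact Equiv.swap_apply_of_ne_of_ne h0 h1
    rw [mul_inv_rev, Equiv.swap_inv, Equiv.swap_inv]
    exact hd.commute.eq.symm

theorem godanGenerators_ne_one (n : ℕ) (hn : 3 ≤ n) {s : Equiv.Perm (Fin n)}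
    (hs : s ∈ godanGenerators n hn) : s ≠ 1 := by
  intro h
  have h0 := congrArg (fun t : Equiv.Perm (Fin n) => (t ⟨0, by omega⟩ : ℕ)) h
  rcases hs with (rfl | rfl | rfl) | ⟨i, hi, rfl⟩
  · simp at h0
  · simp [List.formPerm_cons_cons, Equiv.swap_apply_def] at h0
  · simp [List.formPerm_cons_cons, Equiv.swap_apply_def] at h0
  · have : (⟨0, by omega⟩ : Fin n) ≠ i := by intro e; simp [← e] at hi
    simp [Equiv.swap_apply_def, this] at h0

theorem godanGraph_adj (n : ℕ) (hn : 3 ≤ n) (u v : Equiv.Perm (Fin n)) :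
    (godanGraph n hn).Adj u v ↔ ∃ s ∈ godanGenerators n hn, u = v * s := by
  rw [godanGraph, SimpleGraph.mulCayley_adj']
  constructor
  · rintro ⟨-, g, hg, rfl | h⟩
    · exact ⟨g⁻¹, godanGenerators_inv n hn hg, by simp⟩
    · exact ⟨g, hg, h⟩
  · rintro ⟨s, hs, rfl⟩
    refine ⟨fun h => godanGenerators_ne_one n hn hs (by simpa using h), s, hs, Or.inr rfl⟩

/-! Upper bound. Every vertex has degree at most n, so n trees for two adjacent vertices u, v and a
third vertex w would use exactly one edge each at u and at v. The tree containing the edge uv then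
stops at both ends and misses w (`treeConnectivity_le_of_adj`).

Lower bound. Every generator except (1 2) is even, so the graph consists of the even and the odd
permutations, joined by the perfect matching u ↦ u(1 2). Each half is built up recursively from the
sets `signedCoset w m`, where all entries from position m on are prescribed. Sorting `signedCoset w
(m + 1)` by the entry at position m gives m + 1 clusters of the previous kind, and the generator
that moves position m gives every vertex a gate into another cluster. Induction on m shows that such
a set is (m - 1)-connected and has m - 2 trees for any three vertices (`WellConnected`,
`Clustered.wellConnected`).

Three vertices in different clusters are joined through each unused cluster, and once more inside
their own clusters (`Clustered.setPacking_of_injOn`). If two of them share a cluster U, the other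
clusters form a connected set W into which U is matched (`WellConnected.setPacking_union`). For a
third vertex in U, W supplies one extra tree. For a third vertex in W, Menger's theorem
(`exists_linkage`) gives disjoint paths in U and a fan in W, and the matching connects them. The
same argument applied to the two halves turns n - 2 trees into n - 1.

The constructions only handle vertex sets that link S (`SetPacking`); spanning trees of these are
chosen at the end (`SetPacking.le_treeConnectivity`). -/

namespace SimpleGraph

/-! ### Walks confined to a set of vertices -/

section Linked

variable {V : Type*} {G H : SimpleGraph V} {M N : Set V} {u v w x y : V}

/-- `u` and `v` are joined by a walk of `G` all of whose vertices lie in `M`. -/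
def Linked (G : SimpleGraph V) (M : Set V) (u v : V) : Prop :=
  ∃ p : G.Walk u v, ∀ w ∈ p.support, w ∈ M

namespace Linked

theorem refl (h : u ∈ M) : G.Linked M u u := ⟨.nil, by simpa using h⟩

theorem of_adj (h : G.Adj u v) (hu : u ∈ M) (hv : v ∈ M) : G.Linked M u v :=
  ⟨h.toWalk, by simp [hu, hv]⟩

theorem symm (h : G.Linked M u v) : G.Linked M v u := by
  obtain ⟨p, hp⟩ := h
  exact ⟨p.reverse, by simpa using hp⟩

theorem trans (h : G.Linked M u v) (h' : G.Linked M v w) : G.Linked M u w := by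
  obtain ⟨p, hp⟩ := h
  obtain ⟨q, hq⟩ := h'
  refine ⟨p.append q, fun a ha => ?_⟩
  rcases (Walk.mem_support_append_iff p q).1 ha with h | h
  exacts [hp a h, hq a h]

theorem mem_left (h : G.Linked M u v) : u ∈ M := h.elim fun p hp => hp _ p.start_mem_support

theorem mem_right (h : G.Linked M u v) : v ∈ M := h.elim fun p hp => hp _ p.end_mem_support

theorem mono (h : G.Linked M u v) (hMN : M ⊆ N) : G.Linked N u v :=
  h.elim fun p hp => ⟨p, fun w hw => hMN (hp w hw)⟩

theorem tail (h : G.Linked M u v) (hvw : G.Adj v w) (hw : w ∈ M) : G.Linked M u w :=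
  h.trans (of_adj hvw h.mem_right hw)

/-- The step also receives the link to the current vertex, so that invariants can be compared with
what is reachable inside `M`. -/
theorem induction {motive : V → Prop} (h : G.Linked M u v) (base : motive u)
    (step : ∀ a b, G.Linked M u a → motive a → G.Adj a b → b ∈ M → motive b) : motive v := by
  obtain ⟨p, hp⟩ := h
  have key : ∀ (a b : V) (p : G.Walk a b), (∀ w ∈ p.support, w ∈ M) → G.Linked M u a →
      motive a → motive b := by
    intro a b p
    induction p with
    | nil => exact fun _ _ h => h
    | cons hadj p ih =>
      intro hp hl hm
      have hb := hp _ (List.mem_cons_of_mem _ p.start_mem_support)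
      exact ih (fun w hw => hp w (List.mem_cons_of_mem _ hw)) (hl.tail hadj hb)
        (step _ _ hl hm hadj hb)
  exact key _ _ p hp (refl (hp _ p.start_mem_support)) base

theorem mono_adj (h : G.Linked M u v)
    (hGH : ∀ a ∈ M, ∀ b ∈ M, G.Adj a b → H.Adj a b) : H.Linked M u v :=
  h.induction (refl h.mem_left) fun _ _ hl hm hab hb => hm.tail (hGH _ hl.mem_right _ hb hab) hb

theorem mono_graph (h : G.Linked M u v) (hGH : G ≤ H) : H.Linked M u v :=
  h.mono_adj fun _ _ _ _ hab => hGH hab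

/-- A linking set may be shrunk to the vertex set of a path. -/
theorem exists_path (h : G.Linked M u v) : ∃ P ⊆ M, G.Linked P u v ∧
    (∀ w ∈ P, w ≠ v → G.Linked (P \ {v}) u w) ∧ (∀ w ∈ P, w ≠ u → G.Linked (P \ {u}) w v) := by
  classical
  obtain ⟨p, hp⟩ := h
  refine ⟨{w | w ∈ p.bypass.support}, fun w hw => hp w (p.support_bypass_subset_support hw),
    ⟨p.bypass, fun w hw => hw⟩, fun w hw hne => ?_, fun w hw hne => ?_⟩
  · refine ⟨p.bypass.takeUntil w hw, fun a ha =>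
      ⟨Walk.support_takeUntil_subset_support _ hw ha, ?_⟩⟩
    rintro rfl
    exact Walk.endpoint_notMem_support_takeUntil p.bypass_isPath hw hne.symm ha
  · have hw' : w ∈ p.bypass.reverse.support := by simpa using hw
    refine symm ⟨p.bypass.reverse.takeUntil w hw', fun a ha => ⟨?_, ?_⟩⟩
    · simpa using Walk.support_takeUntil_subset_support _ hw' ha
    · rintro rfl
      exact Walk.endpoint_notMem_support_takeUntil p.bypass_isPath.reverse hw' hne.symm ha

/-- The second vertex of a path is linked to the end of it in the complement of the start. -/
theorem exists_adj (h : G.Linked M u v) (hne : u ≠ v) :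
    ∃ a, G.Adj u a ∧ G.Linked (M \ {u}) a v := by
  classical
  obtain ⟨p, hp⟩ := h
  have hq : ∀ w ∈ p.bypass.support, w ∈ M := fun w hw =>
    hp w (p.support_bypass_subset_support hw)
  have hpath := p.bypass_isPath
  generalize p.bypass = q at hq hpath
  cases q with
  | nil => exact absurd rfl hne
  | cons hadj q =>
    rw [Walk.cons_isPath_iff] at hpath
    refine ⟨_, hadj, q, fun w hw => ⟨hq w (List.mem_cons_of_mem _ hw), ?_⟩⟩
    rintro rfl
    exact hpath.2 hw

end Linked

end Linked

/-! ### Menger's theorem, by deletion of an edge -/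

section Menger

variable {V : Type*} {K : SimpleGraph V} {M A B : Set V} {k : ℕ} {x y : V} {S : Finset V}

theorem deleteEdges_pair_adj {a b : V} (h : K.Adj a b)
    (hne : ¬ (K.deleteEdges {s(x, y)}).Adj a b) : (a = x ∧ b = y) ∨ (a = y ∧ b = x) := by
  simp only [deleteEdges_adj, h, Set.mem_singleton_iff, Sym2.eq_iff, true_and, not_not] at hne
  exact hne

/-- If `S` separates `A` from `B` once the edge `xy` is deleted, then after that deletion a set
separating `A` from `S ∪ {x}` separates `A` from `B` in the whole graph. -/
theorem exists_linked_insert [DecidableEq V]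
    (hsep : ∀ X : Finset V, X.card < k → ∃ a ∈ A, ∃ b ∈ B, K.Linked (M \ X) a b)
    (hS : ¬ ∃ a ∈ A, ∃ b ∈ B, (K.deleteEdges {s(x, y)}).Linked (M \ S) a b)
    (hy : ∃ b ∈ B, (K.deleteEdges {s(x, y)}).Linked (M \ S) y b)
    (X : Finset V) (hX : X.card < k) :
    ∃ a ∈ A, ∃ b ∈ ((insert x S : Finset V) : Set V),
      (K.deleteEdges {s(x, y)}).Linked (M \ X) a b := by
  by_contra hcon
  push Not at hcon
  obtain ⟨a, ha, b, hb, hab⟩ := hsep X hX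
  have hnot : ∀ v, (K.deleteEdges {s(x, y)}).Linked (M \ X) a v → v ∉ insert x S :=
    fun v hv hmem => hcon a ha v hmem hv
  have hlift : ∀ v, (K.deleteEdges {s(x, y)}).Linked (M \ X) a v →
      (K.deleteEdges {s(x, y)}).Linked (M \ S) a v := by
    intro v hv
    have hmem : ∀ w, (K.deleteEdges {s(x, y)}).Linked (M \ X) a w → w ∈ M \ (S : Set V) :=
      fun w hw => ⟨hw.mem_right.1, fun h => hnot w hw (Finset.mem_insert_of_mem h)⟩
    exact hv.induction (.refl (hmem a (.refl hv.mem_left))) fun c d hc hm hcd hd =>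
      hm.tail hcd (hmem d (hc.tail hcd hd))
  refine hS ⟨a, ha, b, hb, hlift b ?_⟩
  refine hab.induction (.refl hab.mem_left) fun c d _ hm hcd hd => ?_
  by_cases hadj : (K.deleteEdges {s(x, y)}).Adj c d
  · exact hm.tail hadj hd
  -- The walk cannot leave `x`, which is not reached; and once at `y` it could continue to `B`
  -- outside `S`, against `hS`.
  rcases deleteEdges_pair_adj hcd hadj with ⟨rfl, rfl⟩ | ⟨rfl, rfl⟩
  · exact absurd (Finset.mem_insert_self _ _) (hnot _ hm)
  · obtain ⟨b', hb', hyb⟩ := hy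
    exact absurd ⟨a, ha, b', hb', (hlift _ hm).trans hyb⟩ hS

/-- A walk from `A` to `B` outside `S` has to cross the edge `xy`; the direction of the crossing
decides which end lies on the side of `A`. The invariant along the walk records whether the current
vertex is reached without the edge, or beyond it in one of the two directions. -/
theorem exists_orientation (hS : ¬ ∃ a ∈ A, ∃ b ∈ B, (K.deleteEdges {s(x, y)}).Linked (M \ S) a b)
    {a b : V} (ha : a ∈ A) (hb : b ∈ B) (hab : K.Linked (M \ S) a b) :
    ((∃ a ∈ A, (K.deleteEdges {s(x, y)}).Linked (M \ S) a x) ∧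
      ∃ b ∈ B, (K.deleteEdges {s(x, y)}).Linked (M \ S) y b) ∨
    ((∃ a ∈ A, (K.deleteEdges {s(x, y)}).Linked (M \ S) a y) ∧
      ∃ b ∈ B, (K.deleteEdges {s(x, y)}).Linked (M \ S) x b) := by
  set K' := K.deleteEdges {s(x, y)} with hK'
  have key : (∃ a ∈ A, K'.Linked (M \ S) a b) ∨
      ((∃ a ∈ A, K'.Linked (M \ S) a x) ∧ K'.Linked (M \ S) y b) ∨
      ((∃ a ∈ A, K'.Linked (M \ S) a y) ∧ K'.Linked (M \ S) x b) := by
    refine hab.induction (motive := fun v => (∃ a ∈ A, K'.Linked (M \ S) a v) ∨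
      ((∃ a ∈ A, K'.Linked (M \ S) a x) ∧ K'.Linked (M \ S) y v) ∨
      ((∃ a ∈ A, K'.Linked (M \ S) a y) ∧ K'.Linked (M \ S) x v))
      (Or.inl ⟨a, ha, .refl hab.mem_left⟩) fun c d _ hm hcd hd => ?_
    by_cases hadj : K'.Adj c d
    · rcases hm with ⟨a', ha', h⟩ | ⟨h, h'⟩ | ⟨h, h'⟩
      · exact Or.inl ⟨a', ha', h.tail hadj hd⟩
      · exact Or.inr (Or.inl ⟨h, h'.tail hadj hd⟩)
      · exact Or.inr (Or.inr ⟨h, h'.tail hadj hd⟩)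
    rcases deleteEdges_pair_adj hcd hadj with ⟨rfl, rfl⟩ | ⟨rfl, rfl⟩
    · rcases hm with h | ⟨h, -⟩ | ⟨h, -⟩
      · exact Or.inr (Or.inl ⟨h, .refl hd⟩)
      · exact Or.inr (Or.inl ⟨h, .refl hd⟩)
      · exact Or.inl h
    · rcases hm with h | ⟨h, -⟩ | ⟨h, -⟩
      · exact Or.inr (Or.inr ⟨h, .refl hd⟩)
      · exact Or.inl h
      · exact Or.inr (Or.inr ⟨h, .refl hd⟩)
  rcases key with ⟨a', ha', h⟩ | ⟨h, h'⟩ | ⟨h, h'⟩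
  · exact absurd ⟨a', ha', b, hb, h⟩ hS
  · exact Or.inl ⟨h, b, hb, h'⟩
  · exact Or.inr ⟨h, b, hb, h'⟩

/-- A family of `k` pairwise disjoint subsets of `M`, the `i`-th of which links a vertex `a i` of
`A` to a vertex `b i` of `B`. -/
structure IsLinkage (K : SimpleGraph V) (M A B : Set V) {ι : Type*} (P : ι → Set V)
    (a b : ι → V) : Prop where
  subset : ∀ i, P i ⊆ M
  start_mem : ∀ i, a i ∈ A
  end_mem : ∀ i, b i ∈ B
  linked : ∀ i, K.Linked (P i) (a i) (b i)
  disjoint : ∀ i j v, v ∈ P i → v ∈ P j → i = j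

theorem IsLinkage.end_injective {ι : Type*} {P : ι → Set V} {a b : ι → V}
    (h : IsLinkage K M A B P a b) : Function.Injective b := fun i j hij =>
  h.disjoint i j _ (h.linked i).mem_right (hij ▸ (h.linked j).mem_right)

theorem IsLinkage.symm {ι : Type*} {P : ι → Set V} {a b : ι → V}
    (h : IsLinkage K M A B P a b) : IsLinkage K M B A P b a :=
  ⟨h.subset, h.end_mem, h.start_mem, fun i => (h.linked i).symm, h.disjoint⟩

/-- In a linkage into a set with no more vertices than there are members, a vertex outside `S` is
linked to `A` in the complement of `S`, provided that `S` is part of that set. -/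
theorem IsLinkage.exists_linked {T : Finset V} {P : Fin k → Set V} {a b : Fin k → V}
    (h : IsLinkage K M A T P a b) (hT : T.card ≤ k) (hST : S ⊆ T)
    (hpath : ∀ i, ∀ w ∈ P i, w ≠ b i → K.Linked (P i \ {b i}) (a i) w)
    {i : Fin k} {v : V} (hv : v ∈ P i) :
    (v ∈ T → v = b i) ∧ (v ∉ S → ∃ a ∈ A, K.Linked (M \ S) a v) := by
  classical
  -- The `k` ends are distinct and `T` has at most `k` elements, so every vertex of `T` is an end;
  -- by disjointness a member meets `T` only in its own end.
  have himg : Finset.univ.image b = T := by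
    apply Finset.eq_of_subset_of_card_le
    · intro w hw
      obtain ⟨j, -, rfl⟩ := Finset.mem_image.1 hw
      exact h.end_mem j
    · rw [Finset.card_image_of_injective _ h.end_injective]
      simpa using hT
  have hmem : ∀ w ∈ P i, w ∈ T → w = b i := by
    intro w hw hwT
    rw [← himg] at hwT
    obtain ⟨j, -, rfl⟩ := Finset.mem_image.1 hwT
    rw [h.disjoint i j _ hw (h.linked j).mem_right]
  refine ⟨hmem v hv, fun hvS => ⟨a i, h.start_mem i, ?_⟩⟩
  by_cases hvb : v = b i
  · subst hvb
    refine (h.linked i).mono fun w hw => ⟨h.subset i hw, fun hwS => ?_⟩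
    have hwb := hmem w hw (hST hwS)
    subst hwb
    exact hvS hwS
  · refine (hpath i v hv hvb).mono fun w hw => ⟨h.subset i hw.1, fun hwS => hw.2 ?_⟩
    exact hmem w hw.1 (hST hwS)

/-- Passing to paths makes the part before the end avoid the end, and the part after the start avoid
the start; `IsLinkage.exists_linked` depends on this. -/
theorem IsLinkage.exists_path {ι : Type*} {P : ι → Set V} {a b : ι → V}
    (h : IsLinkage K M A B P a b) : ∃ P' : ι → Set V, IsLinkage K M A B P' a b ∧
      (∀ i, ∀ w ∈ P' i, w ≠ b i → K.Linked (P' i \ {b i}) (a i) w) ∧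
      (∀ i, ∀ w ∈ P' i, w ≠ a i → K.Linked (P' i \ {a i}) w (b i)) := by
  choose P' hP' hl h1 h2 using fun i => (h.linked i).exists_path
  exact ⟨P', ⟨fun i => (hP' i).trans (h.subset i), h.start_mem, h.end_mem, hl,
    fun i j v hi hj => h.disjoint i j v (hP' i hi) (hP' j hj)⟩, h1, h2⟩

/-- The gluing step. Both linkages exhaust their common frontier `S`, so each link ending in `S`
continues with the link starting there, and the link ending in `x` continues over the edge `xy` with
the one starting in `y`. The map `σ` is this pairing. -/
theorem exists_linkage_of_insert [DecidableEq V] {K' : SimpleGraph V} (hK : K' ≤ K)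
    (hxy : K.Adj x y) (hS : ¬ ∃ a ∈ A, ∃ b ∈ B, K'.Linked (M \ S) a b) (hSk : S.card < k)
    (hyS : y ∉ S)
    (hA : ∃ (P : Fin k → Set V) (a b : Fin k → V),
      IsLinkage K' M A ((insert x S : Finset V) : Set V) P a b)
    (hB : ∃ (P : Fin k → Set V) (a b : Fin k → V),
      IsLinkage K' M ((insert y S : Finset V) : Set V) B P a b) :
    ∃ (P : Fin k → Set V) (a b : Fin k → V), IsLinkage K M A B P a b := by
  obtain ⟨P, a, b, hP⟩ := hA
  obtain ⟨Q, c, d, hQ⟩ := hB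
  obtain ⟨P, hP, hPpath, -⟩ := hP.exists_path
  obtain ⟨Q, hQ, -, hQpath⟩ := hQ.exists_path
  have hcard : ∀ z, (insert z S).card ≤ k := fun z => (Finset.card_insert_le z S).trans hSk
  have hσ : ∀ i, ∃ j, c j = if b i ∈ S then b i else y := by
    have himg : Finset.univ.image c = insert y S := by
      apply Finset.eq_of_subset_of_card_le
      · intro w hw
        obtain ⟨j, -, rfl⟩ := Finset.mem_image.1 hw
        exact hQ.start_mem j
      · rw [Finset.card_image_of_injective _ hQ.symm.end_injective]
        simpa using hcard y
    intro i
    have : (if b i ∈ S then b i else y) ∈ Finset.univ.image c := by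
      rw [himg]
      split_ifs with h
      · exact Finset.mem_insert_of_mem h
      · exact Finset.mem_insert_self _ _
    obtain ⟨j, -, hj⟩ := Finset.mem_image.1 this
    exact ⟨j, hj⟩
  choose σ hσ using hσ
  have hbx : ∀ i, b i ∉ S → b i = x := fun i hi =>
    (Finset.mem_insert.1 (hP.end_mem i)).resolve_right hi
  have hσinj : ∀ i j, σ i = σ j → i = j := by
    intro i j hij
    apply hP.end_injective
    have h := (hσ i).symm.trans ((congrArg c hij).trans (hσ j))
    by_cases hi : b i ∈ S <;> by_cases hj : b j ∈ S <;> simp only [hi, hj, if_true, if_false] at h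
    · exact h
    · exact absurd (h ▸ hi) hyS
    · exact absurd (h ▸ hj) hyS
    · rw [hbx i hi, hbx j hj]
  have hPl := fun i v (hv : v ∈ P i) =>
    hP.exists_linked (hcard x) (Finset.subset_insert x S) hPpath hv
  have hQl := fun i v (hv : v ∈ Q i) =>
    hQ.symm.exists_linked (hcard y) (Finset.subset_insert y S)
      (fun i w hw hne => (hQpath i w hw hne).symm) hv
  -- A common vertex outside `S` would join `A` to `B` in `K'` outside `S`; a common vertex in `S`
  -- is the end of one link and the start of the other.
  have hcross : ∀ i j v, v ∈ P i → v ∈ Q (σ j) → i = j := by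
    intro i j v hi hj
    have hvS : v ∈ S := by
      by_contra hvS
      obtain ⟨a', ha', h⟩ := (hPl i v hi).2 hvS
      obtain ⟨b', hb', h'⟩ := (hQl _ v hj).2 hvS
      exact hS ⟨a', ha', b', hb', h.trans h'.symm⟩
    have h1 := (hPl i v hi).1 (Finset.mem_insert_of_mem hvS)
    have h2 := (hQl _ v hj).1 (Finset.mem_insert_of_mem hvS)
    apply hσinj
    apply hQ.symm.end_injective
    rw [hσ i, if_pos (h1 ▸ hvS), ← h1, h2]
  refine ⟨fun i => P i ∪ Q (σ i), a, fun i => d (σ i),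
    fun i => Set.union_subset (hP.subset i) (hQ.subset _), hP.start_mem, fun i => hQ.end_mem _,
    fun i => ?_, ?_⟩
  · have h1 := ((hP.linked i).mono_graph hK).mono (N := P i ∪ Q (σ i)) Set.subset_union_left
    have h2 := ((hQ.linked (σ i)).mono_graph hK).mono (N := P i ∪ Q (σ i)) Set.subset_union_right
    refine h1.trans (Linked.trans ?_ h2)
    rw [hσ i]
    split_ifs with hi
    · exact .refl h1.mem_right
    · refine .of_adj (by rwa [hbx i hi]) h1.mem_right ?_
      have := h2.mem_left
      rwa [hσ i, if_neg hi] at this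
  · rintro i j v (hi | hi) (hj | hj)
    · exact hP.disjoint i j v hi hj
    · exact hcross i j v hi hj
    · exact (hcross j i v hj hi).symm
    · exact hσinj i j (hQ.disjoint _ _ v hi hj)

/-- **Menger's theorem**: if `A` and `B` cannot be separated within `M` by fewer than `k` vertices,
then there are `k` disjoint links from `A` to `B` within `M`. -/
theorem exists_linkage [Finite V] (M : Set V) (k : ℕ) (K : SimpleGraph V) (A B : Set V)
    (hsep : ∀ X : Finset V, X.card < k → ∃ a ∈ A, ∃ b ∈ B, K.Linked (M \ X) a b) :
    ∃ (P : Fin k → Set V) (a b : Fin k → V), IsLinkage K M A B P a b := by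
  classical
  have := Fintype.ofFinite V
  induction K using WellFoundedLT.induction generalizing A B with
  | ind K ih =>
  by_cases hbot : K = ⊥
  -- Without edges the links are single vertices, and `M ∩ A ∩ B` is itself a separator.
  · have hcard : k ≤ (M ∩ (A ∩ B)).toFinset.card := by
      by_contra hlt
      obtain ⟨a, ha, b, hb, hab⟩ := hsep (M ∩ (A ∩ B)).toFinset (not_le.1 hlt)
      have : a = b := hab.induction (motive := fun v => a = v) rfl
        fun c d _ _ hcd _ => by simp [hbot] at hcd
      subst this
      have := hab.mem_left
      simp_all
    obtain ⟨T, hT, hTk⟩ := Finset.exists_subset_card_eq hcard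
    let e := (Finset.equivFinOfCardEq hTk).symm
    have he : ∀ i, (e i : V) ∈ M ∩ (A ∩ B) := fun i => Set.mem_toFinset.1 (hT (e i).2)
    refine ⟨fun i => {(e i : V)}, fun i => e i, fun i => e i, fun i => ?_, fun i => (he i).2.1,
      fun i => (he i).2.2, fun i => .refl rfl, fun i j v hi hj => ?_⟩
    · simpa using (he i).1
    · exact e.injective (Subtype.ext (hi.symm.trans hj))
  · obtain ⟨x, y, hxy⟩ := ne_bot_iff_exists_adj.1 hbot
    have hlt : K.deleteEdges {s(x, y)} < K := by
      refine lt_of_le_of_ne (deleteEdges_le _) fun h => ?_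
      rw [← h] at hxy
      simp at hxy
    by_cases hsep' : ∀ X : Finset V, X.card < k →
        ∃ a ∈ A, ∃ b ∈ B, (K.deleteEdges {s(x, y)}).Linked (M \ X) a b
    · obtain ⟨P, a, b, h⟩ := ih _ hlt A B hsep'
      exact ⟨P, a, b, h.subset, h.start_mem, h.end_mem,
        fun i => (h.linked i).mono_graph hlt.le, h.disjoint⟩
    push Not at hsep'
    obtain ⟨S, hSk, hS⟩ := hsep'
    have core : ∀ x y, K.Adj x y → K.deleteEdges {s(x, y)} < K →
        (¬ ∃ a ∈ A, ∃ b ∈ B, (K.deleteEdges {s(x, y)}).Linked (M \ S) a b) →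
        (∃ a ∈ A, (K.deleteEdges {s(x, y)}).Linked (M \ S) a x) →
        (∃ b ∈ B, (K.deleteEdges {s(x, y)}).Linked (M \ S) y b) →
        ∃ (P : Fin k → Set V) (a b : Fin k → V), IsLinkage K M A B P a b := by
      intro x y hxy hlt hS hx hy
      have hS' : ¬ ∃ b ∈ B, ∃ a ∈ A, (K.deleteEdges {s(y, x)}).Linked (M \ S) b a := by
        rintro ⟨b, hb, a, ha, h⟩
        rw [Sym2.eq_swap] at h
        exact hS ⟨a, ha, b, hb, h.symm⟩
      refine exists_linkage_of_insert hlt.le hxy hS hSk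
        (hy.elim fun b h => h.2.mem_left.2)
        (ih _ hlt _ _ (exists_linked_insert hsep hS hy)) (ih _ hlt _ _ fun X hX => ?_)
      -- The side of `B` follows by exchanging `A` with `B` and `x` with `y`.
      obtain ⟨b, hb, z, hz, h⟩ := exists_linked_insert (x := y) (y := x)
        (fun X hX => (hsep X hX).elim fun a h => h.2.elim fun b h' => ⟨b, h'.1, a, h.1, h'.2.symm⟩)
        hS' (hx.elim fun a h => ⟨a, h.1, by rw [Sym2.eq_swap]; exact h.2.symm⟩) X hX
      rw [Sym2.eq_swap] at h
      exact ⟨z, hz, b, hb, h.symm⟩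
    have hS' : ¬ ∃ a ∈ A, ∃ b ∈ B, (K.deleteEdges {s(x, y)}).Linked (M \ S) a b := by
      rintro ⟨a, ha, b, hb, h⟩
      exact hS a ha b hb h
    obtain ⟨a, ha, b, hb, hab⟩ := hsep S hSk
    rcases exists_orientation hS' ha hb hab with ⟨h, h'⟩ | ⟨h, h'⟩
    · exact core x y hxy hlt hS' h h'
    · rw [Sym2.eq_swap] at hlt hS' h h'
      exact core y x hxy.symm hlt hS' h h'

end Menger

end SimpleGraph

namespace SimpleGraph

/-! ### Disjoint linking sets in two matched parts -/

section Packing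

variable {V : Type*} {G : SimpleGraph V} {S U W : Set V} {k r : ℕ} {x y z : V}

/-- Any two vertices of `U` are linked in `U` after the removal of fewer than `k` vertices. -/
def ConnectedOn (G : SimpleGraph V) (U : Set V) (k : ℕ) : Prop :=
  ∀ X : Finset V, X.card < k → ∀ x ∈ U \ (X : Set V), ∀ y ∈ U \ (X : Set V),
    G.Linked (U \ X) x y

theorem ConnectedOn.linked (h : G.ConnectedOn U k) (hk : 0 < k) (hx : x ∈ U) (hy : y ∈ U) :
    G.Linked U x y := by
  simpa using h ∅ (by simpa using hk) x (by simpa using hx) y (by simpa using hy)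

/-- The graph `G` without the edges that have both ends in `S`. -/
def off (G : SimpleGraph V) (S : Set V) : SimpleGraph V where
  Adj u v := G.Adj u v ∧ ¬ (u ∈ S ∧ v ∈ S)
  symm := ⟨fun _ _ h => ⟨h.1.symm, fun h' => h.2 ⟨h'.2, h'.1⟩⟩⟩
  loopless := ⟨fun _ h => G.irrefl h.1⟩

theorem off_le (G : SimpleGraph V) (S : Set V) : G.off S ≤ G := fun _ _ h => h.1

/-- `r` subsets of `U` that pairwise meet within `S` and each of which links any two vertices of
`S`, all but at most one of them without using edges between vertices of `S`. -/
def SetPacking (G : SimpleGraph V) (S U : Set V) (r : ℕ) : Prop :=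
  ∃ (ι : Type) (_ : Fintype ι) (A : ι → Set V), Fintype.card ι = r ∧ (∀ i, A i ⊆ U) ∧
    (∀ i j v, v ∈ A i → v ∈ A j → i = j ∨ v ∈ S) ∧
    (∀ i, ∀ s ∈ S, ∀ t ∈ S, G.Linked (A i) s t) ∧
    ∃ N : Set ι, (∀ i j, i ∉ N → j ∉ N → i = j) ∧
      ∀ i ∈ N, ∀ s ∈ S, ∀ t ∈ S, (G.off S).Linked (A i) s t

theorem SetPacking.mono {U' : Set V} (h : G.SetPacking S U r) (hU : U ⊆ U') :
    G.SetPacking S U' r := by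
  obtain ⟨ι, hι, A, hc, hAU, h⟩ := h
  exact ⟨ι, hι, A, hc, fun i => (hAU i).trans hU, h⟩

/-- If `S` lies in `U` and is matched into a connected set `W` outside `U`, then `W` gives one
more tree. -/
theorem SetPacking.succ (h : G.SetPacking S U r) (hSU : S ⊆ U) (hUW : Disjoint U W)
    (hW : ∀ x ∈ W, ∀ y ∈ W, G.Linked W x y) (g : V → V) (hg : ∀ s ∈ S, g s ∈ W)
    (hadj : ∀ s ∈ S, G.Adj s (g s)) : G.SetPacking S (U ∪ W) (r + 1) := by
  obtain ⟨ι, hι, A, hc, hAU, hdisj, hlink, N, hN, hoff⟩ := h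
  have hWS : ∀ w ∈ W, w ∉ S := fun w hw hs => Set.disjoint_left.1 hUW (hSU hs) hw
  have hnew : ∀ s ∈ S, ∀ t ∈ S, (G.off S).Linked (S ∪ W) s t := by
    intro s hs t ht
    have h1 : ∀ s ∈ S, (G.off S).Linked (S ∪ W) s (g s) := fun s hs =>
      .of_adj ⟨hadj s hs, fun h => hWS _ (hg s hs) h.2⟩ (Or.inl hs) (Or.inr (hg s hs))
    have h2 : (G.off S).Linked (S ∪ W) (g s) (g t) :=
      ((hW _ (hg s hs) _ (hg t ht)).mono_adj (H := G.off S) fun a ha b _ hab =>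
        ⟨hab, fun h => hWS a ha h.1⟩).mono Set.subset_union_right
    exact (h1 s hs).trans (h2.trans (h1 t ht).symm)
  have hcross : ∀ i v, v ∈ A i → v ∈ S ∪ W → v ∈ S := fun i v hv hv' =>
    hv'.resolve_right fun hw => Set.disjoint_left.1 hUW (hAU i hv) hw
  -- The new set has index `none`. It avoids the edges inside `S`, so it joins `N` and the possible
  -- exception remains the old one.
  refine ⟨Option ι, inferInstance, fun i => i.elim (S ∪ W) A, by simp [hc], ?_, ?_, ?_,
    {i | ∀ j, i = some j → j ∈ N}, ?_, ?_⟩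
  · rintro (_ | i)
    · exact Set.union_subset_union_left W hSU
    · exact (hAU i).trans Set.subset_union_left
  · rintro (_ | i) (_ | j) v hi hj
    · exact Or.inl rfl
    · exact Or.inr (hcross j v hj hi)
    · exact Or.inr (hcross i v hi hj)
    · exact (hdisj i j v hi hj).imp_left (congrArg some)
  · rintro (_ | i)
    · exact fun s hs t ht => (hnew s hs t ht).mono_graph (off_le G S)
    · exact hlink i
  · rintro (_ | i) (_ | j) hi hj
    · rfl
    · simp at hi
    · simp at hj
    · simp only [Set.mem_ofPred_eq, Option.some.injEq, forall_eq'] at hi hj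
      rw [hN i j hi hj]
  · rintro (_ | i) hi
    · exact hnew
    · exact hoff i (hi i rfl)

variable [Finite V]

/-- The fan lemma: `k` vertices of a `k`-connected set can be linked to a vertex `z` within sets
that pairwise only share `z`. -/
theorem ConnectedOn.exists_fan (hW : G.ConnectedOn W k) (hz : z ∈ W) (B : Finset V)
    (hBW : (B : Set V) ⊆ W) (hB : B.card ≤ k) : ∃ Q : V → Set V,
      (∀ b ∈ B, Q b ⊆ W ∧ G.Linked (Q b) z b) ∧
      ∀ b ∈ B, ∀ b' ∈ B, ∀ v, v ∈ Q b → v ∈ Q b' → b = b' ∨ v = z := by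
  classical
  -- Menger from the neighbours of `z` to `B` inside `W \ {z}`. If `z` itself is in `B`, it needs
  -- only the trivial link.
  obtain ⟨P, a, b, hP⟩ := exists_linkage (W \ {z}) (B.erase z).card G {v | G.Adj z v}
    ((B.erase z : Finset V) : Set V) (by
      intro X hX
      obtain ⟨b, hbB, hbX⟩ := Finset.exists_mem_notMem_of_card_lt_card hX
      have hbz := Finset.ne_of_mem_erase hbB
      obtain ⟨a, hza, hab⟩ := (hW (X.erase z)
        ((Finset.card_erase_le.trans_lt hX).trans_le (Finset.card_erase_le.trans hB)) z
        ⟨hz, by simp⟩ b ⟨hBW (Finset.mem_of_mem_erase hbB), by simp [hbX]⟩).exists_adj hbz.symm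
      refine ⟨a, hza, b, hbB, hab.mono fun v hv => ⟨⟨hv.1.1, hv.2⟩, fun hvX => hv.1.2 ?_⟩⟩
      exact Finset.mem_coe.2 (Finset.mem_erase.2 ⟨hv.2, hvX⟩))
  have himg : Finset.univ.image b = B.erase z := by
    apply Finset.eq_of_subset_of_card_le
    · intro w hw
      obtain ⟨j, -, rfl⟩ := Finset.mem_image.1 hw
      exact hP.end_mem j
    · rw [Finset.card_image_of_injective _ hP.end_injective]
      simp
  refine ⟨fun v => {w | w = z ∨ ∃ i, b i = v ∧ w ∈ P i}, fun v hv => ⟨?_, ?_⟩, ?_⟩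
  · rintro w (rfl | ⟨i, -, hw⟩)
    · exact hz
    · exact (hP.subset i hw).1
  · by_cases hvz : v = z
    · subst hvz
      exact .refl (Or.inl rfl)
    · have hv' : v ∈ Finset.univ.image b := by
        rw [himg]
        exact Finset.mem_erase.2 ⟨hvz, hv⟩
      obtain ⟨i, -, rfl⟩ := Finset.mem_image.1 hv'
      have h1 := (hP.linked i).mono (N := {w | w = z ∨ ∃ j, b j = b i ∧ w ∈ P j})
        fun w hw => Or.inr ⟨i, rfl, hw⟩
      exact (Linked.of_adj (hP.start_mem i) (Or.inl rfl) h1.mem_left).trans h1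
  · rintro c - c' - v (rfl | ⟨i, rfl, hi⟩) (h | ⟨j, rfl, hj⟩)
    · exact Or.inr rfl
    · exact Or.inr rfl
    · exact Or.inr h
    · exact Or.inl (by rw [hP.disjoint i j v hi hj])

/-- The neighbours of `x` and those of `y` are joined by disjoint links avoiding `x` and `y`. -/
theorem ConnectedOn.exists_linkage_neighbors (hU : G.ConnectedOn U k) (hx : x ∈ U) (hy : y ∈ U)
    (hne : x ≠ y) (hcard : k < U.ncard) {l : ℕ} (hl : l + 1 ≤ k ∨ l ≤ k ∧ ¬ G.Adj x y) :
    ∃ (P : Fin l → Set V) (a b : Fin l → V),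
      IsLinkage G ((U \ {x}) \ {y}) {v | G.Adj x v} {v | G.Adj y v} P a b := by
  classical
  have hlk : l ≤ k := by omega
  refine exists_linkage _ _ _ _ _ fun X hX => ?_
  set X' := (X.erase x).erase y with hX'
  have hX'c : X'.card ≤ X.card := Finset.card_erase_le.trans Finset.card_erase_le
  have hsub : ∀ v, v ≠ x → v ≠ y → v ∉ X' → v ∉ X := by
    intro v h1 h2 h3 h4
    exact h3 (by simp [hX', h1, h2, h4])
  have hxX : x ∉ X' := by simp [hX']
  have hyX : y ∉ X' := by simp [hX']
  rcases hl with hl | ⟨-, hadj⟩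
  -- When `xy` may be an edge, `x` and `y` are joined through a third vertex `v`, reached from
  -- either one with the other deleted. That extra deletion is why only `k - 1` links are obtained
  -- here.
  · obtain ⟨v, hvU, hv⟩ : ∃ v ∈ U, v ∉ insert x (insert y X') := by
      by_contra! hcon
      have h1 : U.ncard ≤ (insert x (insert y X')).card := by
        rw [← Set.ncard_coe_finset]
        exact Set.ncard_le_ncard (fun v hv => hcon v hv) (Finset.finite_toSet _)
      have h2 := Finset.card_insert_le x (insert y X')
      have h3 := Finset.card_insert_le y X'
      omega
    simp only [Finset.mem_insert, not_or] at hv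
    have hx1 := hU (insert y X') (by have := Finset.card_insert_le y X'; omega) x
      ⟨hx, by simp [hne, hxX]⟩ v ⟨hvU, by simp [hv]⟩
    have hy1 := hU (insert x X') (by have := Finset.card_insert_le x X'; omega) y
      ⟨hy, by simp [hne.symm, hyX]⟩ v ⟨hvU, by simp [hv]⟩
    obtain ⟨a, hxa, ha⟩ := hx1.exists_adj (Ne.symm hv.1)
    obtain ⟨b, hyb, hb⟩ := hy1.exists_adj (Ne.symm hv.2.1)
    refine ⟨a, hxa, b, hyb, (ha.mono ?_).trans (hb.mono ?_).symm⟩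
    · rintro w ⟨⟨hwU, hwX⟩, hwx⟩
      simp only [Finset.coe_insert, Set.mem_insert_iff, Finset.mem_coe, not_or] at hwX
      exact ⟨⟨⟨hwU, hwx⟩, hwX.1⟩, hsub w hwx hwX.1 hwX.2⟩
    · rintro w ⟨⟨hwU, hwX⟩, hwy⟩
      simp only [Finset.coe_insert, Set.mem_insert_iff, Finset.mem_coe, not_or] at hwX
      exact ⟨⟨⟨hwU, hwX.1⟩, hwy⟩, hsub w hwX.1 hwy hwX.2⟩
  · have h := hU X' (by omega) x ⟨hx, hxX⟩ y ⟨hy, hyX⟩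
    obtain ⟨a, hxa, ha⟩ := h.exists_adj hne
    obtain ⟨b, hyb, hb⟩ := ha.symm.exists_adj (u := y) (by rintro rfl; exact hadj hxa)
    refine ⟨a, hxa, b, hyb, hb.symm.mono ?_⟩
    rintro w ⟨⟨⟨hwU, hwX⟩, hwx⟩, hwy⟩
    exact ⟨⟨⟨hwU, hwx⟩, hwy⟩, hsub w hwx hwy hwX⟩

/-- Internally disjoint links between two vertices of a `k`-connected set, with distinct
representatives; all but one of the links avoid the edge `xy`. -/
theorem ConnectedOn.exists_paths (hU : G.ConnectedOn U k) (hk : 0 < k) (hx : x ∈ U) (hy : y ∈ U)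
    (hne : x ≠ y) (hcard : k < U.ncard) :
    ∃ (ι : Type) (_ : Fintype ι) (P : ι → Set V) (a : ι → V) (N : Set ι), Fintype.card ι = k ∧
      (∀ i, P i ⊆ U) ∧ (∀ i j v, v ∈ P i → v ∈ P j → i = j ∨ v = x ∨ v = y) ∧
      Function.Injective a ∧ (∀ i, G.Linked (P i) x y ∧ G.Linked (P i) x (a i)) ∧
      (∀ i j, i ∉ N → j ∉ N → i = j) ∧
      ∀ i ∈ N, a i ≠ x ∧ a i ≠ y ∧
        (G.off {x, y}).Linked (P i) x y ∧ (G.off {x, y}).Linked (P i) x (a i) := by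
  classical
  have main : ∀ l (P : Fin l → Set V) (a b : Fin l → V),
      IsLinkage G ((U \ {x}) \ {y}) {v | G.Adj x v} {v | G.Adj y v} P a b →
      (∀ i, a i ≠ x ∧ a i ≠ y) ∧ ∀ i, (G.off {x, y}).Linked (insert x (insert y (P i))) x y ∧
        (G.off {x, y}).Linked (insert x (insert y (P i))) x (a i) := by
    intro l P a b h
    have hP : ∀ i, ∀ v ∈ P i, v ≠ x ∧ v ≠ y := fun i v hv =>
      ⟨(h.subset i hv).1.2, (h.subset i hv).2⟩
    refine ⟨fun i => hP i _ (h.linked i).mem_left, fun i => ?_⟩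
    have h1 : (G.off {x, y}).Linked (insert x (insert y (P i))) (a i) (b i) :=
      ((h.linked i).mono_adj (H := G.off {x, y}) fun c hc d _ hcd => ⟨hcd, fun h' => by
        have := hP i c hc
        simp_all⟩).mono fun v hv => Or.inr (Or.inr hv)
    have ha := hP i _ (h.linked i).mem_left
    have hb := hP i _ (h.linked i).mem_right
    have hxa : (G.off {x, y}).Linked (insert x (insert y (P i))) x (a i) :=
      .of_adj ⟨h.start_mem i, by simp [ha]⟩ (Or.inl rfl) h1.mem_left
    have hyb : (G.off {x, y}).Linked (insert x (insert y (P i))) y (b i) :=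
      .of_adj ⟨h.end_mem i, by simp [hb]⟩ (Or.inr (Or.inl rfl)) h1.mem_right
    exact ⟨hxa.trans (h1.trans hyb.symm), hxa⟩
  have hsub : ∀ l (P : Fin l → Set V) (a b : Fin l → V),
      IsLinkage G ((U \ {x}) \ {y}) {v | G.Adj x v} {v | G.Adj y v} P a b →
      ∀ i, insert x (insert y (P i)) ⊆ U := by
    rintro l P a b h i v (rfl | rfl | hv)
    · exact hx
    · exact hy
    · exact (h.subset i hv).1.1
  by_cases hadj : G.Adj x y
  -- The edge `xy` is the missing path. It alone is outside `N`, and its representative is `x`,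
  -- which no other path uses.
  · obtain ⟨l, rfl⟩ : ∃ l, k = l + 1 := ⟨k - 1, by omega⟩
    obtain ⟨P, a, b, h⟩ := hU.exists_linkage_neighbors hx hy hne hcard (l := l) (Or.inl le_rfl)
    obtain ⟨ha, hl⟩ := main l P a b h
    refine ⟨Option (Fin l), inferInstance,
      fun i => i.elim {x, y} fun i => insert x (insert y (P i)),
      fun i => i.elim x a, {i | i ≠ none}, by simp, ?_, ?_, ?_, ?_, ?_, ?_⟩
    · rintro (_ | i)
      · rintro v (rfl | rfl)
        exacts [hx, hy]
      · exact hsub l P a b h i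
    · rintro (_ | i) (_ | j) v hi hj
      · exact Or.inl rfl
      · exact Or.inr hi
      · exact Or.inr hj
      · rcases hi with hi | hi | hi
        · exact Or.inr (Or.inl hi)
        · exact Or.inr (Or.inr hi)
        rcases hj with hj | hj | hj
        · exact Or.inr (Or.inl hj)
        · exact Or.inr (Or.inr hj)
        exact Or.inl (by rw [h.disjoint i j v hi hj])
    · rintro (_ | i) (_ | j) hij
      · rfl
      · exact absurd hij.symm (ha j).1
      · exact absurd hij (ha i).1
      · exact congrArg some (h.symm.end_injective hij)
    · rintro (_ | i)
      · exact ⟨.of_adj hadj (Or.inl rfl) (Or.inr rfl), .refl (Or.inl rfl)⟩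
      · exact ⟨(hl i).1.mono_graph (off_le _ _), (hl i).2.mono_graph (off_le _ _)⟩
    · intro i j hi hj
      simp only [Set.mem_ofPred_eq, not_not] at hi hj
      rw [hi, hj]
    · rintro (_ | i) hi
      · exact absurd rfl hi
      · exact ⟨(ha i).1, (ha i).2, hl i⟩
  · obtain ⟨P, a, b, h⟩ :=
      hU.exists_linkage_neighbors hx hy hne hcard (l := k) (Or.inr ⟨le_rfl, hadj⟩)
    obtain ⟨ha, hl⟩ := main k P a b h
    refine ⟨Fin k, inferInstance, fun i => insert x (insert y (P i)), a, Set.univ, by simp,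
      hsub k P a b h, ?_, h.symm.end_injective,
      fun i => ⟨(hl i).1.mono_graph (off_le _ _), (hl i).2.mono_graph (off_le _ _)⟩,
      fun i j hi => absurd (Set.mem_univ i) hi, fun i _ => ⟨(ha i).1, (ha i).2, hl i⟩⟩
    rintro i j v (hi | hi | hi) (hj | hj | hj)
    all_goals first
      | exact Or.inl (h.disjoint i j v hi hj)
      | exact Or.inr (Or.inl ‹v = x›)
      | exact Or.inr (Or.inr ‹v = y›)

/-- If `x, y` lie in a `k`-connected set that is matched into a `k`-connected set containing `z`,
then there are `k` trees for `x, y, z`. -/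
theorem ConnectedOn.setPacking (hU : G.ConnectedOn U k) (hW : G.ConnectedOn W k) (hk : 0 < k)
    (hUW : Disjoint U W) (hx : x ∈ U) (hy : y ∈ U) (hz : z ∈ W) (hne : x ≠ y)
    (hcard : k < U.ncard) (g : V → V) (hg : ∀ u ∈ U, g u ∈ W)
    (hginj : ∀ u ∈ U, ∀ v ∈ U, g u = g v → u = v) (hadj : ∀ u ∈ U, G.Adj u (g u)) :
    G.SetPacking {x, y, z} (U ∪ W) k := by
  classical
  obtain ⟨ι, hι, P, a, N, hc, hPU, hdisj, hainj, hlink, hN, hoff⟩ :=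
    hU.exists_paths hk hx hy hne hcard
  have haU : ∀ i, a i ∈ U := fun i => hPU i (hlink i).2.mem_right
  have hinj : ∀ i j, g (a i) = g (a j) → i = j := fun i j h =>
    hainj (hginj _ (haU i) _ (haU j) h)
  obtain ⟨Q, hQ, hQdisj⟩ := hW.exists_fan hz (Finset.univ.image fun i => g (a i))
    (by rintro v hv; obtain ⟨i, -, rfl⟩ := Finset.mem_image.1 hv; exact hg _ (haU i))
    (Finset.card_image_le.trans (by simp [hc]))
  have hmem : ∀ i, g (a i) ∈ Finset.univ.image fun i => g (a i) := fun i =>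
    Finset.mem_image_of_mem _ (Finset.mem_univ i)
  have hUz : ∀ u ∈ U, u ≠ z := fun u hu h => Set.disjoint_left.1 hUW hu (h ▸ hz)
  have hWx : ∀ w ∈ W, w ≠ x ∧ w ≠ y := fun w hw =>
    ⟨fun h => Set.disjoint_left.1 hUW hx (h ▸ hw), fun h => Set.disjoint_left.1 hUW hy (h ▸ hw)⟩
  have hthree : ∀ (H : SimpleGraph V) (A : Set V), H.Linked A x y → H.Linked A x z →
      ∀ s ∈ ({x, y, z} : Set V), ∀ t ∈ ({x, y, z} : Set V), H.Linked A s t := by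
    intro H A h1 h2
    have : ∀ s ∈ ({x, y, z} : Set V), H.Linked A x s := by
      rintro s (rfl | rfl | rfl)
      exacts [.refl h1.mem_left, h1, h2]
    exact fun s hs t ht => (this s hs).symm.trans (this t ht)
  -- Path number `i` in `U` leaves at its representative `a i`, crosses the matching and follows the
  -- fan in `W` to `z`. For `i ∈ N` the crossing edge has its end `a i` outside `S`, even when `g (a
  -- i) = z`.
  refine ⟨ι, hι, fun i => P i ∪ Q (g (a i)), hc, fun i => Set.union_subset_union (hPU i)
    (hQ _ (hmem i)).1, ?_, fun i => ?_, N, hN, fun i hi => ?_⟩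
  · have hcross : ∀ i j v, v ∈ P i → v ∉ Q (g (a j)) := fun i j v hi hj =>
      Set.disjoint_left.1 hUW (hPU i hi) ((hQ _ (hmem j)).1 hj)
    rintro i j v (hi | hi) (hj | hj)
    · rcases hdisj i j v hi hj with h | h | h <;> simp [h]
    · exact absurd hj (hcross i j v hi)
    · exact absurd hi (hcross j i v hj)
    · rcases hQdisj _ (hmem i) _ (hmem j) v hi hj with h | h
      · exact Or.inl (hinj i j h)
      · simp [h]
  · have h1 := (hlink i).1.mono (N := P i ∪ Q (g (a i))) Set.subset_union_left
    have h2 := (hlink i).2.mono (N := P i ∪ Q (g (a i))) Set.subset_union_left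
    have h3 := (hQ _ (hmem i)).2.mono (N := P i ∪ Q (g (a i))) Set.subset_union_right
    exact hthree G _ h1 (h2.trans ((Linked.of_adj (hadj _ (haU i)) h2.mem_right h3.mem_right).trans
      h3.symm))
  · obtain ⟨hax, hay, h1, h2⟩ := hoff i hi
    have lift : ∀ v, (G.off {x, y}).Linked (P i) x v →
        (G.off {x, y, z}).Linked (P i ∪ Q (g (a i))) x v := fun v hv =>
      (hv.mono_adj (H := G.off {x, y, z}) fun c hc d hd hcd => ⟨hcd.1, fun h' => hcd.2 (by
        have hcz := hUz c (hPU i hc)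
        have hdz := hUz d (hPU i hd)
        simp_all)⟩).mono Set.subset_union_left
    have h3 : (G.off {x, y, z}).Linked (P i ∪ Q (g (a i))) z (g (a i)) :=
      ((hQ _ (hmem i)).2.mono_adj (H := G.off {x, y, z}) fun c hc d hd hcd => ⟨hcd, fun h' => by
        have hcx := hWx c ((hQ _ (hmem i)).1 hc)
        have hdx := hWx d ((hQ _ (hmem i)).1 hd)
        have := hcd.ne
        simp_all⟩).mono Set.subset_union_right
    have haz := hUz _ (haU i)
    refine hthree _ _ (lift _ h1) ((lift _ h2).trans (Linked.trans ?_ h3.symm))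
    exact .of_adj ⟨hadj _ (haU i), by simp [hax, hay, haz]⟩ (lift _ h2).mem_right h3.mem_right

end Packing

end SimpleGraph

namespace SimpleGraph

/-! ### Connectivity and trees in a set divided into clusters -/

section Clusters

variable {V : Type*} {L : Type} {G : SimpleGraph V} {D U W : Set V} {m : ℕ} {x y z : V}

/-- `D` behaves like a graph of degree `m - 1` with the largest possible connectivity, and with
`m - 2` trees for any three vertices. -/
structure WellConnected (G : SimpleGraph V) (D : Set V) (m : ℕ) : Prop where
  connectedOn : G.ConnectedOn D (m - 1)
  le_ncard : m ≤ D.ncard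
  setPacking : ∀ x ∈ D, ∀ y ∈ D, ∀ z ∈ D, x ≠ y → x ≠ z → y ≠ z →
    G.SetPacking {x, y, z} D (m - 2)

theorem WellConnected.of_pairwise_adj (hD : ∀ x ∈ D, ∀ y ∈ D, x ≠ y → G.Adj x y)
    (h3 : 3 ≤ D.ncard) : G.WellConnected D 3 := by
  refine ⟨fun X _ x hx y hy => ?_, h3, fun x hx y hy z hz _ _ _ => ?_⟩
  · by_cases hxy : x = y
    · subst hxy
      exact .refl hx
    · exact .of_adj (hD x hx.1 y hy.1 hxy) hx hy
  · refine ⟨Unit, inferInstance, fun _ => D, rfl, fun _ => le_rfl, fun _ _ _ _ _ => Or.inl rfl,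
      fun _ s hs t ht => ?_, ∅, fun _ _ _ _ => rfl, fun _ h => h.elim⟩
    have hmem : ∀ s ∈ ({x, y, z} : Set V), s ∈ D := by
      rintro s (rfl | rfl | rfl) <;> assumption
    by_cases hst : s = t
    · subst hst
      exact .refl (hmem s hs)
    · exact .of_adj (hD s (hmem s hs) t (hmem t ht) hst) (hmem s hs) (hmem t ht)

/-- If `z` is in `U`, then `W` adds one tree to the `m - 2` inside `U`; if `z` is in `W`, paths in
`U` and a fan in `W` give all `m - 1`. -/
theorem WellConnected.setPacking_union [Finite V] (hU : G.WellConnected U m)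
    (hW : G.ConnectedOn W (m - 1)) (hm : 2 ≤ m) (hUW : Disjoint U W) (g : V → V)
    (hg : ∀ u ∈ U, g u ∈ W) (hginj : ∀ u ∈ U, ∀ v ∈ U, g u = g v → u = v)
    (hadj : ∀ u ∈ U, G.Adj u (g u)) (hx : x ∈ U) (hy : y ∈ U) (hz : z ∈ U ∪ W)
    (hxy : x ≠ y) (hxz : x ≠ z) (hyz : y ≠ z) :
    G.SetPacking {x, y, z} (U ∪ W) (m - 1) := by
  rcases hz with hz | hz
  · have hS : ∀ s ∈ ({x, y, z} : Set V), s ∈ U := by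
      rintro s (rfl | rfl | rfl) <;> assumption
    have := (hU.setPacking x hx y hy z hz hxy hxz hyz).succ hS hUW
      (fun a ha b hb => hW.linked (by omega) ha hb) g (fun s hs => hg s (hS s hs))
      fun s hs => hadj s (hS s hs)
    rwa [show m - 2 + 1 = m - 1 by omega] at this
  · exact hU.connectedOn.setPacking hW (by omega) hUW hx hy hz hxy
      (by have := hU.le_ncard; omega) g hg hginj hadj

/-- Two matched well-connected parts. -/
theorem WellConnected.setPacking_of_matching [Finite V] (hU : G.WellConnected U m)
    (hW : G.WellConnected W m) (hm : 2 ≤ m) (hUW : Disjoint U W) (g : V → V)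
    (hgU : ∀ u ∈ U, g u ∈ W) (hgW : ∀ w ∈ W, g w ∈ U) (hg : Function.Injective g)
    (hadj : ∀ u, G.Adj u (g u)) (hx : x ∈ U ∪ W) (hy : y ∈ U ∪ W) (hz : z ∈ U ∪ W)
    (hxy : x ≠ y) (hxz : x ≠ z) (hyz : y ≠ z) :
    G.SetPacking {x, y, z} (U ∪ W) (m - 1) := by
  have key : ∀ x y z, x ∈ U ∪ W → y ∈ U ∪ W → z ∈ U ∪ W → x ≠ y → x ≠ z → y ≠ z →
      (x ∈ U ∧ y ∈ U ∨ x ∈ W ∧ y ∈ W) → G.SetPacking {x, y, z} (U ∪ W) (m - 1) := by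
    rintro x y z - - hz hxy hxz hyz (⟨hx, hy⟩ | ⟨hx, hy⟩)
    · exact hU.setPacking_union hW.connectedOn hm hUW g hgU (fun _ _ _ _ h => hg h)
        (fun u _ => hadj u) hx hy hz hxy hxz hyz
    · rw [Set.union_comm] at hz ⊢
      exact hW.setPacking_union hU.connectedOn hm hUW.symm g hgW (fun _ _ _ _ h => hg h)
        (fun u _ => hadj u) hx hy hz hxy hxz hyz
  -- Two of the three vertices lie in the same part, so one of three orderings applies.
  have h1 := key x y z hx hy hz hxy hxz hyz
  have h2 := key x z y hx hz hy hxz hxy hyz.symm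
  have h3 := key y z x hy hz hx hyz hxy.symm hxz.symm
  rw [show ({x, z, y} : Set V) = {x, y, z} by grind] at h2
  rw [show ({y, z, x} : Set V) = {x, y, z} by grind] at h3
  grind

/-- `D` is divided into clusters by the labels `c v ∈ I`. Every vertex `v` has a gate `g v` in
another cluster, and `v` and its neighbours in its cluster have gates in all other clusters. -/
structure Clustered (G : SimpleGraph V) (D : Set V) (I : Finset L) (c : V → L) (g : V → V) :
    Prop where
  label_mem : ∀ v ∈ D, c v ∈ I
  gate_mem : ∀ v ∈ D, g v ∈ D
  gate_gate : ∀ v ∈ D, g (g v) = v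
  gate_adj : ∀ v ∈ D, G.Adj v (g v)
  gate_label : ∀ v ∈ D, c (g v) ≠ c v
  exists_gate : ∀ v ∈ D, ∀ j ∈ I, j ≠ c v →
    ∃ u, u ∈ D ∧ c u = c v ∧ (u = v ∨ G.Adj v u) ∧ c (g u) = j

namespace Clustered

variable {I J : Finset L} {c : V → L} {g : V → V}

theorem exists_label (h : G.Clustered D I c g) (hD : D.Nonempty) {j : L} (hj : j ∈ I) :
    ∃ v ∈ D, c v = j := by
  obtain ⟨v, hv⟩ := hD
  by_cases hvj : j = c v
  · exact ⟨v, hv, hvj.symm⟩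
  · obtain ⟨u, hu, -, -, hgu⟩ := h.exists_gate v hv j hj hvj
    exact ⟨g u, h.gate_mem u hu, hgu⟩

/-- Outside a small set `X`, every vertex is linked to a cluster not met by `X`. -/
theorem exists_linked_free (h : G.Clustered D I c g) (hJ : J ⊆ I) {X : Finset V}
    (hX : X.card < J.card - 1) {v : V} (hv : v ∈ {v ∈ D | c v ∈ J} \ (X : Set V)) :
    ∃ w ∈ D, c w ∈ J ∧ (∀ u ∈ X, c u ≠ c w) ∧ G.Linked ({v ∈ D | c v ∈ J} \ X) v w := by
  classical
  obtain ⟨⟨hvD, hvJ⟩, hvX⟩ := hv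
  -- A vertex of `X` spoils at most one label `j`: its own, or that of its gate if it lies in the
  -- cluster of `v`. As `X` has fewer than `J.card - 1` vertices, some label stays unspoiled.
  obtain ⟨j, hj, hjX⟩ : ∃ j ∈ J.erase (c v),
      ∀ u ∈ X, ¬ (c u = c v ∧ c (g u) = j) ∧ c u ≠ j := by
    by_contra! hcon
    have hφ : ∀ j ∈ J.erase (c v), ∃ u ∈ X, (c u = c v ∧ c (g u) = j) ∨ c u = j := by
      intro j hj
      obtain ⟨u, hu, h'⟩ := hcon j hj
      refine ⟨u, hu, ?_⟩
      tauto
    have : Nonempty V := ⟨v⟩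
    choose! φ hφX hφ using hφ
    have hle : (J.erase (c v)).card ≤ X.card := by
      refine Finset.card_le_card_of_injOn φ hφX fun a ha b hb hab => ?_
      have h1 := hφ a ha
      have h2 := hφ b hb
      have h3 := Finset.ne_of_mem_erase ha
      have h4 := Finset.ne_of_mem_erase hb
      rw [hab] at h1
      grind
    rw [Finset.card_erase_of_mem hvJ] at hle
    omega
  obtain ⟨hjv, hjJ⟩ := Finset.mem_erase.1 hj
  obtain ⟨u, huD, huc, huv, hgu⟩ := h.exists_gate v hvD j (hJ hjJ) hjv
  have huX : u ∉ X := fun hu => (hjX u hu).1 ⟨huc, hgu⟩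
  have hguX : g u ∉ X := fun hu => (hjX _ hu).2 hgu
  refine ⟨g u, h.gate_mem u huD, hgu ▸ hjJ, fun w hw => hgu ▸ (hjX w hw).2, ?_⟩
  have hu : u ∈ {v ∈ D | c v ∈ J} \ (X : Set V) := ⟨⟨huD, huc ▸ hvJ⟩, huX⟩
  have hvu : G.Linked ({v ∈ D | c v ∈ J} \ X) v u := by
    rcases huv with rfl | huv
    · exact .refl hu
    · exact .of_adj huv ⟨⟨hvD, hvJ⟩, hvX⟩ hu
  exact hvu.tail (h.gate_adj u huD) ⟨⟨h.gate_mem u huD, hgu ▸ hjJ⟩, hguX⟩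

/-- Every remaining vertex reaches a cluster free of `X`, and any two free clusters are joined by an
edge to a gate. -/
theorem connectedOn (h : G.Clustered D I c g) (hJ : J ⊆ I)
    (hlink : ∀ j ∈ I, ∀ x ∈ {v ∈ D | c v = j}, ∀ y ∈ {v ∈ D | c v = j},
      G.Linked {v ∈ D | c v = j} x y) :
    G.ConnectedOn {v ∈ D | c v ∈ J} (J.card - 1) := by
  intro X hX x hx y hy
  obtain ⟨a, haD, haJ, haX, hxa⟩ := h.exists_linked_free hJ hX hx
  obtain ⟨b, hbD, hbJ, hbX, hyb⟩ := h.exists_linked_free hJ hX hy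
  have hsub : ∀ j ∈ J, (∀ u ∈ X, c u ≠ j) →
      {v ∈ D | c v = j} ⊆ {v ∈ D | c v ∈ J} \ (X : Set V) := by
    rintro j hj hjX v ⟨hvD, rfl⟩
    exact ⟨⟨hvD, hj⟩, fun hv => hjX v hv rfl⟩
  refine hxa.trans (Linked.trans ?_ hyb.symm)
  have hcl : ∀ j ∈ J, (∀ u ∈ X, c u ≠ j) → ∀ s ∈ D, ∀ t ∈ D, c s = j → c t = j →
      G.Linked ({v ∈ D | c v ∈ J} \ (X : Set V)) s t := fun j hj hjX s hs t ht hsj htj =>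
    (hlink j (hJ hj) s ⟨hs, hsj⟩ t ⟨ht, htj⟩).mono (hsub j hj hjX)
  by_cases hab : c b = c a
  · exact hcl _ haJ haX a haD b hbD rfl hab
  · obtain ⟨u, huD, huc, -, hgu⟩ := h.exists_gate a haD (c b) (hJ hbJ) hab
    have h1 := hcl _ haJ haX a haD u huD rfl huc
    have h2 := hcl _ hbJ hbX (g u) (h.gate_mem u huD) b hbD hgu rfl
    exact (h1.tail (h.gate_adj u huD) h2.mem_left).trans h2

/-- For each label `j` not used by `S`, every `s ∈ S` enters cluster `j` through `nb s j`. What is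
left of the clusters of `S` after removing these vertices (but not `S`) still links `S`, since at
most `I.card - S.card < k` vertices are lost in each. Only this last set, of index `none`, may use
edges inside `S`. -/
theorem setPacking_of_injOn (h : G.Clustered D I c g) (S : Finset V) (hSD : (S : Set V) ⊆ D)
    (hS : Set.InjOn c S) {k : ℕ} (hk : I.card - S.card < k)
    (hconn : ∀ j ∈ I, G.ConnectedOn {v ∈ D | c v = j} k) :
    G.SetPacking S D (I.card - S.card + 1) := by
  classical
  choose! nb hnbD hnbc hnbadj hnbg using h.exists_gate
  set J := I \ S.image c with hJ
  have hcard : J.card = I.card - S.card := by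
    rw [hJ, Finset.card_sdiff_of_subset, Finset.card_image_of_injOn hS]
    intro j hj
    obtain ⟨s, hs, rfl⟩ := Finset.mem_image.1 hj
    exact h.label_mem s (hSD hs)
  have hJI : ∀ j ∈ J, j ∈ I := fun j hj => (Finset.mem_sdiff.1 hj).1
  have hJS : ∀ j ∈ J, ∀ s ∈ S, j ≠ c s := fun j hj s hs hjs =>
    (Finset.mem_sdiff.1 hj).2 (Finset.mem_image.2 ⟨s, hs, hjs.symm⟩)
  set A : Option J → Set V := fun i => i.elim
    {v | v ∈ D ∧ (∃ s ∈ S, c v = c s) ∧ ∀ s ∈ S, ∀ j ∈ J, v = nb s j → v = s}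
    fun j => {v | v ∈ S ∨ (v ∈ D ∧ c v = j) ∨ ∃ s ∈ S, v = nb s j} with hA
  have hsome : ∀ j : J, ∀ s ∈ S, ∀ t ∈ S, (G.off S).Linked (A (some j)) s t := by
    rintro ⟨j, hj⟩
    have hout : ∀ v, c v = j → v ∉ (S : Set V) := fun v hv hvS => hJS j hj v hvS hv.symm
    have hstart : ∀ s ∈ S, (G.off S).Linked (A (some ⟨j, hj⟩)) s (g (nb s j)) := by
      intro s hs
      have hsD := hSD hs
      have hjs := hJS j hj s hs
      have hn := hnbD s hsD j (hJI j hj) hjs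
      have hgn := hnbg s hsD j (hJI j hj) hjs
      have hadj : (G.off S).Adj (nb s j) (g (nb s j)) :=
        ⟨h.gate_adj _ hn, fun h' => hout _ hgn h'.2⟩
      have hnA : nb s j ∈ A (some ⟨j, hj⟩) := Or.inr (Or.inr ⟨s, hs, rfl⟩)
      have hl : (G.off S).Linked (A (some ⟨j, hj⟩)) s (nb s j) := by
        rcases hnbadj s hsD j (hJI j hj) hjs with heq | hadj'
        · rw [heq] at hnA ⊢
          exact .refl hnA
        · refine .of_adj ⟨hadj', fun h' => hadj'.ne ?_⟩ (Or.inl hs) hnA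
          exact (hS h'.2 h'.1 (hnbc s hsD j (hJI j hj) hjs)).symm
      exact hl.tail hadj (Or.inr (Or.inl ⟨h.gate_mem _ hn, hgn⟩))
    have hgate : ∀ s ∈ S, g (nb s j) ∈ {v ∈ D | c v = j} := fun s hs =>
      ⟨h.gate_mem _ (hnbD s (hSD hs) j (hJI j hj) (hJS j hj s hs)),
        hnbg s (hSD hs) j (hJI j hj) (hJS j hj s hs)⟩
    intro s hs t ht
    refine (hstart s hs).trans (Linked.trans ?_ (hstart t ht).symm)
    refine (((hconn j (hJI j hj)).linked (by omega) (hgate s hs) (hgate t ht)).mono_adj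
      (H := G.off S) fun a ha b _ hab => ⟨hab, fun h' => hout a ha.2 h'.1⟩).mono ?_
    exact fun v hv => Or.inr (Or.inl hv)
  have hnone : ∀ s ∈ S, ∀ t ∈ S, G.Linked (A none) s t := by
    have hF : ∀ s ∈ S, ∀ v ∈ D, c v = c s → (∀ j ∈ J, v ≠ nb s j) →
        G.Linked (A none) s v := by
      intro s hs v hv hvs hvJ
      have hl := hconn (c s) (h.label_mem s (hSD hs)) ((J.image (nb s)).erase s)
        ((Finset.card_erase_le.trans (Finset.card_image_le.trans hcard.le)).trans_lt hk)
        s ⟨⟨hSD hs, rfl⟩, by simp⟩ v ⟨⟨hv, hvs⟩, ?_⟩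
      · refine hl.mono ?_
        rintro w ⟨⟨hwD, hws⟩, hwX⟩
        refine ⟨hwD, ⟨s, hs, hws⟩, ?_⟩
        rintro s' hs' j hj rfl
        have hss' : s' = s := hS hs' hs
          ((hnbc s' (hSD hs') j (hJI j hj) (hJS j hj s' hs')).symm.trans hws)
        subst hss'
        by_contra hne
        exact hwX (Finset.mem_coe.2
          (Finset.mem_erase.2 ⟨hne, Finset.mem_image.2 ⟨j, hj, rfl⟩⟩))
      · intro hmem
        obtain ⟨j, hj, hjv⟩ := Finset.mem_image.1 (Finset.mem_of_mem_erase (Finset.mem_coe.1 hmem))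
        exact hvJ j hj hjv.symm
    intro s hs t ht
    by_cases hst : c t = c s
    · rw [hS ht hs hst]
      exact .refl ⟨hSD hs, ⟨s, hs, rfl⟩, fun s' hs' j hj hsj => hS hs hs'
        ((congrArg c hsj).trans (hnbc s' (hSD hs') j (hJI j hj) (hJS j hj s' hs')))⟩
    · have htI := h.label_mem t (hSD ht)
      have hu := hnbD s (hSD hs) _ htI hst
      have huc := hnbc s (hSD hs) _ htI hst
      have hug := hnbg s (hSD hs) _ htI hst
      -- The edge between the clusters of `s` and `t` survives: its ends have gates labelled `c t`
      -- and `c s`, whereas a removed vertex has its gate in an unused cluster.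
      have h1 : G.Linked (A none) s (nb s (c t)) := hF s hs _ hu huc fun j hj hjn =>
        hJS j hj t ht (by
          rw [← hnbg s (hSD hs) j (hJI j hj) (hJS j hj s hs), ← hjn, hug])
      have h2 : G.Linked (A none) t (g (nb s (c t))) := hF t ht _ (h.gate_mem _ hu) hug
        fun j hj hjn => hJS j hj s hs (by
          rw [← hnbg t (hSD ht) j (hJI j hj) (hJS j hj t ht), ← hjn, h.gate_gate _ hu, huc])
      exact (h1.tail (h.gate_adj _ hu) h2.mem_right).trans h2.symm
  refine ⟨Option J, inferInstance, A, by simp [hcard], ?_, ?_, ?_, {i | i ≠ none}, ?_, ?_⟩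
  · rintro (_ | ⟨j, hj⟩) v hv
    · exact hv.1
    · rcases hv with hv | hv | ⟨s, hs, rfl⟩
      · exact hSD hv
      · exact hv.1
      · exact hnbD s (hSD hs) j (hJI j hj) (hJS j hj s hs)
  · have hns : ∀ v, v ∈ A none → ∀ j, v ∈ A (some j) → v ∈ S := by
      rintro v ⟨-, ⟨s, hs, hvs⟩, hvn⟩ ⟨j, hj⟩ (hv | hv | ⟨s', hs', hv⟩)
      · exact hv
      · exact absurd (hv.2.symm.trans hvs) (hJS j hj s hs)
      · exact hvn s' hs' j hj hv ▸ hs'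
    have hlab : ∀ s ∈ S, ∀ j ∈ J, ∀ j' ∈ J, c (nb s j) ≠ j' := fun s hs j hj j' hj' heq =>
      hJS j' hj' s hs (heq.symm.trans (hnbc s (hSD hs) j (hJI j hj) (hJS j hj s hs)))
    rintro (_ | ⟨j, hj⟩) (_ | ⟨j', hj'⟩) v hi hi'
    · exact Or.inl rfl
    · exact Or.inr (hns v hi _ hi')
    · exact Or.inr (hns v hi' _ hi)
    · rcases hi with hi | hi | ⟨s, hs, rfl⟩
      · exact Or.inr hi
      · rcases hi' with hi' | hi' | ⟨s, hs, rfl⟩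
        · exact Or.inr hi'
        · have : j = j' := hi.2.symm.trans hi'.2
          subst this
          exact Or.inl rfl
        · exact absurd hi.2 (hlab s hs j' hj' j hj)
      · rcases hi' with hi' | hi' | ⟨s', hs', heq⟩
        · exact Or.inr hi'
        · exact absurd hi'.2 (hlab s hs j hj j' hj')
        · have h1 := hnbg s (hSD hs) j (hJI j hj) (hJS j hj s hs)
          rw [heq, hnbg s' (hSD hs') j' (hJI j' hj') (hJS j' hj' s' hs')] at h1
          subst h1
          exact Or.inl rfl
  · rintro (_ | j)
    · exact hnone
    · exact fun s hs t ht => (hsome j s hs t ht).mono_graph (off_le _ _)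
  · intro i j hi hj
    simp only [Set.mem_ofPred_eq, not_not] at hi hj
    rw [hi, hj]
  · rintro (_ | j) hi
    · exact absurd rfl hi
    · exact hsome j

/-- A set divided into `m + 1` clusters that are well connected for `m` is well connected for
`m + 1`. -/
theorem wellConnected [Finite V] (h : G.Clustered D I c g) (hD : D.Nonempty) (hm : 3 ≤ m)
    (hI : I.card = m + 1) (hcl : ∀ j ∈ I, G.WellConnected {v ∈ D | c v = j} m) :
    G.WellConnected D (m + 1) := by
  classical
  have hlink : ∀ j ∈ I, ∀ x ∈ {v ∈ D | c v = j}, ∀ y ∈ {v ∈ D | c v = j},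
      G.Linked {v ∈ D | c v = j} x y := fun j hj x hx y hy =>
    (hcl j hj).connectedOn.linked (by omega) hx hy
  have hDI : {v ∈ D | c v ∈ I} = D := by
    ext v
    exact ⟨fun hv => hv.1, fun hv => ⟨hv, h.label_mem v hv⟩⟩
  have hpair : ∀ x ∈ D, ∀ y ∈ D, ∀ z ∈ D, x ≠ y → x ≠ z → y ≠ z → c x = c y →
      G.SetPacking {x, y, z} D (m - 1) := by
    intro x hx y hy z hz hxy hxz hyz hc
    -- The `m` other clusters together form an `(m - 1)`-connected set, and the gates match the
    -- cluster of `x` and `y` into it.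
    have hW := h.connectedOn (Finset.erase_subset (c x) I) hlink
    rw [Finset.card_erase_of_mem (h.label_mem x hx), hI, Nat.add_sub_cancel] at hW
    refine ((hcl (c x) (h.label_mem x hx)).setPacking_union hW (by omega) ?_ g ?_ ?_ ?_
      ⟨hx, rfl⟩ ⟨hy, hc.symm⟩ ?_ hxy hxz hyz).mono ?_
    · rw [Set.disjoint_left]
      rintro v ⟨-, hv⟩ ⟨-, hv'⟩
      exact Finset.ne_of_mem_erase hv' hv
    · rintro u ⟨hu, huc⟩
      exact ⟨h.gate_mem u hu, Finset.mem_erase.2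
        ⟨huc ▸ h.gate_label u hu, h.label_mem _ (h.gate_mem u hu)⟩⟩
    · rintro u ⟨hu, -⟩ v ⟨hv, -⟩ huv
      rw [← h.gate_gate u hu, huv, h.gate_gate v hv]
    · exact fun u hu => h.gate_adj u hu.1
    · by_cases hcz : c z = c x
      · exact Or.inl ⟨hz, hcz⟩
      · exact Or.inr ⟨hz, Finset.mem_erase.2 ⟨hcz, h.label_mem z hz⟩⟩
    · rintro v (hv | hv) <;> exact hv.1
  refine ⟨?_, ?_, fun x hx y hy z hz hxy hxz hyz => ?_⟩
  · have := h.connectedOn le_rfl hlink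
    rwa [hDI, hI] at this
  · have hsub : (I : Set L) ⊆ c '' D := fun j hj => h.exists_label hD hj
    have h1 := Set.ncard_le_ncard hsub (Set.toFinite _)
    have h2 := Set.ncard_image_le (f := c) (Set.toFinite D)
    rw [Set.ncard_coe_finset, hI] at h1
    omega
  · rw [show m + 1 - 2 = m - 1 by omega]
    by_cases h1 : c x = c y
    · exact hpair x hx y hy z hz hxy hxz hyz h1
    by_cases h2 : c x = c z
    · rw [show ({x, y, z} : Set V) = {x, z, y} by grind]
      exact hpair x hx z hz y hy hxz hxy hyz.symm h2
    by_cases h3 : c y = c z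
    · rw [show ({x, y, z} : Set V) = {y, z, x} by grind]
      exact hpair y hy z hz x hx hyz hxy.symm hxz.symm h3
    have hcard : ({x, y, z} : Finset V).card = 3 := Finset.card_eq_three.2
      ⟨x, y, z, hxy, hxz, hyz, rfl⟩
    have := h.setPacking_of_injOn {x, y, z} (k := m - 1) (by
        intro v hv
        simp only [Finset.coe_insert, Finset.coe_singleton, Set.mem_insert_iff,
          Set.mem_singleton_iff] at hv
        rcases hv with rfl | rfl | rfl <;> assumption) (by
        intro a ha b hb hab
        simp only [Finset.coe_insert, Finset.coe_singleton, Set.mem_insert_iff,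
          Set.mem_singleton_iff] at ha hb
        rcases ha with rfl | rfl | rfl <;> rcases hb with rfl | rfl | rfl <;> simp_all)
      (by omega) fun j hj => (hcl j hj).connectedOn
    rw [hcard, hI, show m + 1 - 3 + 1 = m - 1 by omega] at this
    simpa using this

end Clustered

end Clusters

end SimpleGraph

namespace SimpleGraph

/-! ### From linking sets to trees, and the degree bound -/

section Trees

variable {V : Type*} {G H : SimpleGraph V} {S A U : Set V} {r n : ℕ} {u v w s : V}

/-- A set that links the vertices of `S` contains the vertices of an `S`-tree. -/
theorem exists_isSTree (hHG : H ≤ G) (hs : s ∈ S) (hA : ∀ t ∈ S, H.Linked A s t) :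
    ∃ T : G.Subgraph, G.IsSTree S T ∧ T.verts ⊆ A ∧ ∀ u v, T.Adj u v → H.Adj u v := by
  set C : Set V := {v | H.Linked A s v} with hC
  have hsC : s ∈ C := .refl (hA s hs).mem_left
  have hCl : ∀ v ∈ C, H.Linked C s v := fun v hv =>
    hv.induction (motive := fun v => H.Linked C s v) (.refl hsC)
      fun a b ha hm hab hb => hm.tail hab (ha.tail hab hb)
  have hconn : (H.induce C).Connected := by
    rw [connected_iff_exists_forall_reachable]
    refine ⟨⟨s, hsC⟩, fun ⟨v, hv⟩ => ?_⟩
    obtain ⟨p, hp⟩ := hCl v hv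
    exact ⟨p.induce C hp⟩
  obtain ⟨T₀, hle, hT₀⟩ := hconn.exists_isTree_le
  let T : G.Subgraph :=
    { verts := C
      Adj := fun u v => ∃ (hu : u ∈ C) (hv : v ∈ C), T₀.Adj ⟨u, hu⟩ ⟨v, hv⟩
      adj_sub := fun ⟨_, _, h⟩ => hHG (hle h)
      edge_vert := fun ⟨hu, _, _⟩ => hu
      symm := ⟨fun _ _ ⟨hu, hv, h⟩ => ⟨hv, hu, h.symm⟩⟩ }
  have hT : T.coe = T₀ := by
    ext ⟨a, ha⟩ ⟨b, hb⟩
    exact ⟨fun ⟨_, _, h⟩ => h, fun h => ⟨ha, hb, h⟩⟩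
  exact ⟨T, ⟨hT ▸ hT₀, fun t ht => hA t ht⟩, fun v hv => hv.mem_right,
    fun _ _ ⟨_, _, h⟩ => hle h⟩

/-- Two of the trees meet only within `S`, so a common edge would have both ends in `S`; at most one
tree has such edges. -/
theorem SetPacking.le_treeConnectivity (h : G.SetPacking S U r) (hS : S.Nonempty) :
    (r : ℕ∞) ≤ G.treeConnectivity S := by
  classical
  obtain ⟨ι, hι, A, rfl, -, hdisj, hlink, N, hN, hoff⟩ := h
  obtain ⟨s, hs⟩ := hS
  have hT : ∀ i, ∃ T : G.Subgraph, G.IsSTree S T ∧ T.verts ⊆ A i ∧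
      (i ∈ N → ∀ u v, T.Adj u v → (G.off S).Adj u v) := by
    intro i
    by_cases hi : i ∈ N
    · obtain ⟨T, h1, h2, h3⟩ := exists_isSTree (off_le G S) hs (hoff i hi s hs)
      exact ⟨T, h1, h2, fun _ => h3⟩
    · obtain ⟨T, h1, h2, -⟩ := exists_isSTree le_rfl hs (hlink i s hs)
      exact ⟨T, h1, h2, fun h => absurd h hi⟩
  choose T hT hTA hToff using hT
  let e := (Fintype.equivFin ι).symm
  have hmeet : ∀ i j, i ≠ j → ∀ v ∈ (T i).verts, v ∈ (T j).verts → v ∈ S :=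
    fun i j hij v hi hj => (hdisj i j v (hTA i hi) (hTA j hj)).resolve_left hij
  refine le_iSup₂_of_le (Fintype.card ι) ⟨fun i => T (e i), fun i => hT _, fun i j hij => ?_,
    fun i j hij => ?_⟩ le_rfl
  · refine Set.Subset.antisymm (fun v hv => hmeet _ _ (e.injective.ne hij) v hv.1 hv.2)
      fun v hv => ⟨(hT _).subset_verts hv, (hT _).subset_verts hv⟩
  · rw [Set.eq_empty_iff_forall_notMem]
    intro a
    induction a with | _ u v
    rintro ⟨hi, hj⟩
    rw [Subgraph.mem_edgeSet] at hi hj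
    have hu := hmeet _ _ (e.injective.ne hij) u hi.fst_mem hj.fst_mem
    have hv := hmeet _ _ (e.injective.ne hij) v hi.snd_mem hj.snd_mem
    by_cases hiN : e i ∈ N
    · exact (hToff _ hiN u v hi).2 ⟨hu, hv⟩
    by_cases hjN : e j ∈ N
    · exact (hToff _ hjN u v hj).2 ⟨hu, hv⟩
    exact hij (e.injective (hN _ _ hiN hjN))

theorem IsSTree.exists_adj {T : G.Subgraph} (hT : G.IsSTree S T) (hu : u ∈ S) (hw : w ∈ S)
    (hne : u ≠ w) : ∃ a, T.Adj u a := by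
  have hconn := hT.isTree.connected
  have : Nontrivial T.verts :=
    ⟨⟨u, hT.subset_verts hu⟩, ⟨w, hT.subset_verts hw⟩, by simpa using hne⟩
  obtain ⟨a, ha⟩ := hconn.preconnected.exists_adj_of_nontrivial ⟨u, hT.subset_verts hu⟩
  exact ⟨a, ha⟩

theorem InternallyEdgeDisjointSTrees.eq_of_adj {T : Fin r → G.Subgraph}
    (hT : G.InternallyEdgeDisjointSTrees S T) {i j : Fin r} (hi : (T i).Adj u v)
    (hj : (T j).Adj u v) : i = j := by
  by_contra hij
  have : s(u, v) ∈ (T i).edgeSet ∩ (T j).edgeSet := ⟨hi, hj⟩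
  rw [hT.edge_disjoint i j hij] at this
  exact this

/-- If there are as many trees as the degree of `u ∈ S`, then every tree uses one edge at `u`, and
every edge at `u` is used. -/
theorem InternallyEdgeDisjointSTrees.adj_of_degree_le [Finite V] {T : Fin r → G.Subgraph}
    (hT : G.InternallyEdgeDisjointSTrees S T) (hu : u ∈ S) (hw : w ∈ S) (hne : u ≠ w)
    (hdeg : (G.neighborSet u).ncard ≤ r) :
    (∀ i a b, (T i).Adj u a → (T i).Adj u b → a = b) ∧
      ∀ a, G.Adj u a → ∃ i, (T i).Adj u a := by
  classical
  have := Fintype.ofFinite V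
  -- One neighbour of `u` per tree. The choice is injective by edge disjointness, hence exhausts the
  -- neighbours because `r` is at least the degree.
  choose f hf using fun i => (hT.isSTree i).exists_adj hu hw hne
  have hinj : ∀ i j a, (T i).Adj u a → f j = a → i = j := fun i j a hi hj =>
    hT.eq_of_adj hi (hj ▸ hf j)
  have himg : Finset.univ.image f = (G.neighborSet u).toFinset := by
    apply Finset.eq_of_subset_of_card_le
    · intro a ha
      obtain ⟨i, -, rfl⟩ := Finset.mem_image.1 ha
      exact Set.mem_toFinset.2 (hf i).adj_sub
    · rw [Finset.card_image_of_injective _ fun i j h => hinj i j _ (hf i) h.symm,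
        ← Set.ncard_eq_toFinset_card']
      simpa using hdeg
  have hex : ∀ a, G.Adj u a → ∃ i, f i = a := by
    intro a ha
    have : a ∈ Finset.univ.image f := by
      rw [himg]
      exact Set.mem_toFinset.2 ha
    obtain ⟨i, -, hi⟩ := Finset.mem_image.1 this
    exact ⟨i, hi⟩
  refine ⟨?_, fun a ha => ?_⟩
  rotate_left
  · obtain ⟨i, rfl⟩ := hex a ha
    exact ⟨i, hf i⟩
  have key : ∀ i a, (T i).Adj u a → f i = a := by
    intro i a ha
    obtain ⟨j, hj⟩ := hex a ha.adj_sub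
    rw [hinj i j a ha hj, hj]
  exact fun i a b ha hb => (key i a ha).symm.trans (key i b hb)

/-- Three vertices, two of which are adjacent and of degree at most `n`, have at most `n - 1`
internally edge disjoint trees. -/
theorem treeConnectivity_le_of_adj [Finite V] (huv : G.Adj u v) (hwu : w ≠ u) (hwv : w ≠ v)
    (hu : (G.neighborSet u).ncard ≤ n) (hv : (G.neighborSet v).ncard ≤ n) :
    G.treeConnectivity {u, v, w} ≤ ((n - 1 : ℕ) : ℕ∞) := by
  refine iSup₂_le fun r ⟨T, hT⟩ => ?_
  rw [Nat.cast_le]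
  by_contra hlt
  have hr : n ≤ r := by omega
  have huS : u ∈ ({u, v, w} : Set V) := by simp
  have hvS : v ∈ ({u, v, w} : Set V) := by simp
  have hwS : w ∈ ({u, v, w} : Set V) := by simp
  obtain ⟨hu1, hu2⟩ := hT.adj_of_degree_le huS hwS hwu.symm (hu.trans hr)
  obtain ⟨hv1, -⟩ := hT.adj_of_degree_le hvS hwS hwv.symm (hv.trans hr)
  obtain ⟨i, hi⟩ := hu2 v huv
  have hTi := hT.isSTree i
  obtain ⟨p⟩ := hTi.isTree.connected ⟨u, hTi.subset_verts huS⟩ ⟨w, hTi.subset_verts hwS⟩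
  -- In the tree through `uv` both ends are leaves, so walks from `u` never leave `{u, v}`.
  have key : ∀ (a b : (T i).verts), (T i).coe.Walk a b → (a : V) = u ∨ (a : V) = v →
      (b : V) = u ∨ (b : V) = v := by
    intro a b p
    induction p with
    | nil => exact id
    | @cons a b c hab p ih =>
      rintro (h | h)
      · exact ih (Or.inr (hu1 i b v (h ▸ hab) hi))
      · exact ih (Or.inl (hv1 i b u (h ▸ hab) hi.symm))
  exact (key _ _ p (Or.inl rfl)).elim hwu hwv

end Trees

end SimpleGraph

/-! ### The recursive structure of the godan graph -/

section Godan

open Equiv Equiv.Perm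

variable {n m : ℕ}

/-- The permutations with the sign of `w` that agree with `w` from the position `m` on. -/
def signedCoset (w : Perm (Fin n)) (m : ℕ) : Set (Perm (Fin n)) :=
  {u | sign u = sign w ∧ ∀ i : Fin n, m ≤ (i : ℕ) → u i = w i}

theorem mul_mem_signedCoset {u w s : Perm (Fin n)} (hu : u ∈ signedCoset w m) (hs : sign s = 1)
    (hfix : ∀ i : Fin n, m ≤ (i : ℕ) → s i = i) : u * s ∈ signedCoset w m :=
  ⟨by rw [Perm.sign_mul, hs, mul_one, hu.1], fun i hi => by rw [mul_apply, hfix i hi, hu.2 i hi]⟩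

theorem godanGraph_adj_mul (hn : 3 ≤ n) (u : Perm (Fin n)) {s : Perm (Fin n)}
    (hs : s ∈ godanGenerators n hn) : (godanGraph n hn).Adj u (u * s) :=
  ((godanGraph_adj n hn _ _).2 ⟨s, hs, rfl⟩).symm

/-- The generators that are even and fix the positions from `m` on send the third position to all
positions before `m`. -/
theorem exists_generator_apply_third (hn : 3 ≤ n) (hm : 3 ≤ m) (i : Fin n) (hi : (i : ℕ) < m) :
    ∃ s : Perm (Fin n), (s = 1 ∨ s ∈ godanGenerators n hn) ∧ s ⟨2, by omega⟩ = i ∧ sign s = 1 ∧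
      ∀ k : Fin n, m ≤ (k : ℕ) → s k = k := by
  have hsign : ∀ a b c d : Fin n, a ≠ b → c ≠ d → sign (swap a b * swap c d) = 1 := by
    intro a b c d hab hcd
    rw [Perm.sign_mul, sign_swap hab, sign_swap hcd]
    rfl
  have hfix : ∀ a b c d k : Fin n, k ≠ a → k ≠ b → k ≠ c → k ≠ d →
      (swap a b * swap c d) k = k := by
    intro a b c d k ha hb hc hd
    rw [mul_apply, swap_apply_of_ne_of_ne hc hd, swap_apply_of_ne_of_ne ha hb]
  have h012 : i = ⟨0, by omega⟩ ∨ i = ⟨1, by omega⟩ ∨ i = ⟨2, by omega⟩ ∨ 3 ≤ (i : ℕ) := by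
    simp only [Fin.ext_iff]
    omega
  rcases h012 with h | h | h | h3
  · rw [h]
    refine ⟨List.formPerm [⟨0, by omega⟩, ⟨1, by omega⟩, ⟨2, by omega⟩], Or.inr ?_, ?_, ?_, ?_⟩
    · exact Or.inl (Or.inr (Or.inl rfl))
    all_goals rw [List.formPerm_cons_cons, List.formPerm_pair]
    · simp
    · exact hsign _ _ _ _ (by simp) (by simp)
    · intro k hk
      apply hfix <;> (simp only [ne_eq, Fin.ext_iff]; omega)
  · rw [h]
    refine ⟨List.formPerm [⟨0, by omega⟩, ⟨2, by omega⟩, ⟨1, by omega⟩], Or.inr ?_, ?_, ?_, ?_⟩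
    · exact Or.inl (Or.inr (Or.inr rfl))
    all_goals rw [List.formPerm_cons_cons, List.formPerm_pair]
    · simp [swap_apply_def]
    · exact hsign _ _ _ _ (by simp) (by simp)
    · intro k hk
      apply hfix <;> (simp only [ne_eq, Fin.ext_iff]; omega)
  · exact ⟨1, Or.inl rfl, h.symm, Perm.sign_one, fun _ _ => rfl⟩
  · refine ⟨swap ⟨0, by omega⟩ ⟨1, by omega⟩ * swap ⟨2, by omega⟩ i, Or.inr ?_, ?_, ?_, ?_⟩
    · exact Or.inr ⟨i, h3, rfl⟩
    · rw [mul_apply, swap_apply_left]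
      apply swap_apply_of_ne_of_ne <;> (simp only [ne_eq, Fin.ext_iff]; omega)
    · exact hsign _ _ _ _ (by simp) (by rw [Ne, Fin.ext_iff]; dsimp only; omega)
    · intro k hk
      apply hfix <;> (simp only [ne_eq, Fin.ext_iff]; omega)

/-- An even permutation that fixes all but two positions is trivial. -/
theorem eq_one_of_sign_eq_one {s : Perm (Fin n)} (hs : sign s = 1)
    (hfix : ∀ i : Fin n, 2 ≤ (i : ℕ) → s i = i) : s = 1 := by
  by_contra hne
  have hcard : s.support.card ≤ 2 := by
    have hsub : s.support.image Fin.val ⊆ Finset.range 2 := by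
      intro i hi
      obtain ⟨k, hk, rfl⟩ := Finset.mem_image.1 hi
      rw [Finset.mem_range]
      by_contra hlt
      exact mem_support.1 hk (hfix k (by omega))
    have := Finset.card_le_card hsub
    rwa [Finset.card_image_of_injective _ Fin.val_injective, Finset.card_range] at this
  have h2 := two_le_card_support_of_ne_one hne
  have hswap : s.IsSwap := card_support_eq_two.1 (le_antisymm hcard h2)
  rw [hswap.sign_eq] at hs
  exact absurd hs (by decide)

theorem eq_of_mem_signedCoset_two {u v w : Perm (Fin n)} (hu : u ∈ signedCoset w 2)
    (hv : v ∈ signedCoset w 2) : u = v := by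
  have : v⁻¹ * u = 1 := by
    apply eq_one_of_sign_eq_one
    · rw [Perm.sign_mul, sign_inv, hu.1, hv.1]
      exact Int.units_mul_self _
    · intro i hi
      rw [mul_apply, hu.2 i hi, ← hv.2 i hi, coe_inv, symm_apply_apply]
  exact (inv_mul_eq_one.1 this).symm

theorem wellConnected_signedCoset_three (hn : 3 ≤ n) (w : Perm (Fin n)) :
    (godanGraph n hn).WellConnected (signedCoset w 3) 3 := by
  have hex := fun i hi => exists_generator_apply_third hn (m := 3) le_rfl i hi
  refine .of_pairwise_adj (fun u hu v hv huv => ?_) ?_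
  -- The generator taking the third position to `i` makes the third entry of `u` that of `v`; the
  -- first two entries are then settled by the sign.
  · set i := u⁻¹ (v ⟨2, by omega⟩) with hi
    have hui : u i = v ⟨2, by omega⟩ := by rw [hi, coe_inv, apply_symm_apply]
    have hi3 : (i : ℕ) < 3 := by
      by_contra hlt
      have h1 := hu.2 i (by omega)
      rw [← hv.2 i (by omega), hui] at h1
      have h2 := congrArg Fin.val (v.injective h1)
      dsimp only at h2
      omega
    obtain ⟨s, hs, hs2, hsign, hsfix⟩ := hex i hi3
    have hus := mul_mem_signedCoset hu hsign hsfix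
    have heq : u * s = v := by
      apply eq_of_mem_signedCoset_two (w := v)
      · refine ⟨by rw [hus.1, hv.1], fun k hk => ?_⟩
        by_cases hk2 : (k : ℕ) = 2
        · rw [show k = ⟨2, by omega⟩ from Fin.ext hk2, mul_apply, hs2, hui]
        · rw [hus.2 k (by omega), hv.2 k (by omega)]
      · exact ⟨rfl, fun _ _ => rfl⟩
    rcases hs with rfl | hs
    · exact absurd (by simpa using heq) huv
    · exact heq ▸ godanGraph_adj_mul hn u hs
  · choose! s _ hs2 hsign hsfix using hex
    have hw : w ∈ signedCoset w 3 := ⟨rfl, fun _ _ => rfl⟩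
    set F : Finset (Perm (Fin n)) :=
      (Finset.univ.filter fun i : Fin n => (i : ℕ) < 3).image fun i => w * s i with hF
    have hFcard : F.card = 3 := by
      rw [hF, Finset.card_image_of_injOn]
      · rw [Fin.card_filter_val_lt]
        omega
      · intro i hi j hj hij
        have := congrArg (fun t : Perm (Fin n) => t ⟨2, by omega⟩) (mul_left_cancel hij)
        simp only [Finset.coe_filter, Finset.mem_univ, true_and, Set.mem_ofPred_eq] at hi hj
        simpa [hs2 i hi, hs2 j hj] using this
    suffices hsub : (F : Set (Perm (Fin n))) ⊆ signedCoset w 3 by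
      have := Set.ncard_le_ncard hsub (Set.toFinite _)
      rwa [Set.ncard_coe_finset, hFcard] at this
    intro t ht
    obtain ⟨i, hi, rfl⟩ := Finset.mem_image.1 (Finset.mem_coe.1 ht)
    have hi := (Finset.mem_filter.1 hi).2
    exact mul_mem_signedCoset hw (hsign i hi) (hsfix i hi)

/-- The gate of `u` carries at position `m` the third entry of `u`. Even generators fixing the
positions from `m` on stay in the cluster and bring any of the first `m` entries to the third
position, so all other labels occur. -/
theorem clustered_signedCoset (hn : 3 ≤ n) (hm : 3 ≤ m) (hmn : m < n) (w : Perm (Fin n)) :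
    (godanGraph n hn).Clustered (signedCoset w (m + 1)) ((Finset.Iic ⟨m, hmn⟩).image w)
      (fun u => u ⟨m, hmn⟩)
      (fun u => u * (swap ⟨0, by omega⟩ ⟨1, by omega⟩ * swap ⟨2, by omega⟩ ⟨m, hmn⟩)) := by
  set t : Perm (Fin n) := swap ⟨0, by omega⟩ ⟨1, by omega⟩ * swap ⟨2, by omega⟩ ⟨m, hmn⟩ with ht
  have ht1 : sign t = 1 := by
    rw [ht, Perm.sign_mul, sign_swap (by simp), sign_swap (by rw [Ne, Fin.ext_iff]; dsimp only; omega)]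
    rfl
  have htm : t ⟨m, hmn⟩ = ⟨2, by omega⟩ := by
    rw [ht, mul_apply, swap_apply_right]
    exact swap_apply_of_ne_of_ne (by simp) (by simp)
  have htfix : ∀ i : Fin n, m + 1 ≤ (i : ℕ) → t i = i := by
    intro i hi
    rw [ht, mul_apply]
    have h1 : swap ⟨2, by omega⟩ ⟨m, hmn⟩ i = i := by
      apply swap_apply_of_ne_of_ne <;> (simp only [ne_eq, Fin.ext_iff]; omega)
    rw [h1]
    apply swap_apply_of_ne_of_ne <;> (simp only [ne_eq, Fin.ext_iff]; omega)
  have htt : t * t = 1 := by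
    have hcomm : Commute (swap (⟨0, by omega⟩ : Fin n) ⟨1, by omega⟩)
        (swap ⟨2, by omega⟩ ⟨m, hmn⟩) := by
      refine (disjoint_swap_swap ?_).commute
      simp only [List.nodup_cons, List.mem_cons, Fin.ext_iff, List.not_mem_nil]
      simp
      omega
    rw [ht, hcomm.symm.mul_mul_mul_comm, swap_mul_self, swap_mul_self, one_mul]
  have htgen : t ∈ godanGenerators n hn := Or.inr ⟨⟨m, hmn⟩, hm, rfl⟩
  have hpos : ∀ u ∈ signedCoset w (m + 1), ∀ v ∈ signedCoset w (m + 1), ∀ i : Fin n,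
      (i : ℕ) ≤ m → ((v⁻¹ (u i) : Fin n) : ℕ) ≤ m := by
    intro u hu v hv i hi
    by_contra hlt
    have h1 := hv.2 (v⁻¹ (u i)) (by omega)
    rw [← hu.2 _ (by omega), coe_inv, apply_symm_apply] at h1
    rw [coe_inv, ← u.injective h1] at hlt
    exact hlt hi
  have hw : w ∈ signedCoset w (m + 1) := ⟨rfl, fun _ _ => rfl⟩
  refine ⟨fun u hu => ?_, fun u hu => mul_mem_signedCoset hu ht1 htfix, fun u _ => ?_,
    fun u _ => godanGraph_adj_mul hn u htgen, fun u _ h => ?_, fun u hu j hj hju => ?_⟩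
  · exact Finset.mem_image.2 ⟨w⁻¹ (u ⟨m, hmn⟩),
      Finset.mem_Iic.2 (hpos u hu w hw ⟨m, hmn⟩ le_rfl), w.apply_symm_apply _⟩
  · rw [mul_assoc, htt, mul_one]
  · simp only [mul_apply, htm] at h
    have := congrArg Fin.val (u.injective h)
    dsimp only at this
    omega
  · obtain ⟨i₀, hi₀, rfl⟩ := Finset.mem_image.1 hj
    set i := u⁻¹ (w i₀) with hi
    have him : (i : ℕ) ≤ m := hpos w hw u hu i₀ (Fin.le_def.1 (Finset.mem_Iic.1 hi₀))
    have hne : (i : ℕ) ≠ m := by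
      intro h
      apply hju
      rw [← show i = ⟨m, hmn⟩ from Fin.ext h, hi, coe_inv, apply_symm_apply]
    obtain ⟨s, hs, hs2, hsign, hsfix⟩ :=
      exists_generator_apply_third hn hm i (lt_of_le_of_ne him hne)
    refine ⟨u * s, mul_mem_signedCoset hu hsign fun k hk => hsfix k (by omega), ?_, ?_, ?_⟩
    · simp only [mul_apply, hsfix ⟨m, hmn⟩ le_rfl]
    · rcases hs with rfl | hs
      · exact Or.inl (mul_one u)
      · exact Or.inr (godanGraph_adj_mul hn u hs)
    · simp only [mul_apply, htm, hs2]
      rw [hi, coe_inv, apply_symm_apply]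

theorem wellConnected_signedCoset (hn : 3 ≤ n) (hm : 3 ≤ m) (hmn : m ≤ n) (w : Perm (Fin n)) :
    (godanGraph n hn).WellConnected (signedCoset w m) m := by
  induction m, hm using Nat.le_induction generalizing w with
  | base => exact wellConnected_signedCoset_three hn w
  | succ m hm ih =>
    have hD : (signedCoset w (m + 1)).Nonempty := ⟨w, rfl, fun _ _ => rfl⟩
    have hc := clustered_signedCoset hn hm hmn w
    refine hc.wellConnected hD hm ?_ fun j hj => ?_
    · rw [Finset.card_image_of_injective _ w.injective, Fin.card_Iic]
    · obtain ⟨u, hu, rfl⟩ := hc.exists_label hD hj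
      -- A cluster is the signed coset of any of its members with one more position prescribed.
      convert ih (by omega) u using 1
      ext v
      constructor
      · rintro ⟨hv, hvm⟩
        refine ⟨hv.1.trans hu.1.symm, fun i hi => ?_⟩
        by_cases him : (i : ℕ) = m
        · rwa [show i = ⟨m, hmn⟩ from Fin.ext him]
        · rw [hv.2 i (by omega), hu.2 i (by omega)]
      · intro hv
        exact ⟨⟨hv.1.trans hu.1, fun i hi => (hv.2 i (by omega)).trans (hu.2 i hi)⟩,
          hv.2 _ le_rfl⟩

theorem ncard_neighborSet_godanGraph_le (hn : 3 ≤ n) (u : Perm (Fin n)) :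
    ((godanGraph n hn).neighborSet u).ncard ≤ n := by
  classical
  set R := (Finset.univ.filter fun i : Fin n => 3 ≤ (i : ℕ)).image fun i =>
    swap (⟨0, by omega⟩ : Fin n) ⟨1, by omega⟩ * swap ⟨2, by omega⟩ i with hR
  have hRcard : R.card ≤ n - 3 := by
    refine Finset.card_image_le.trans ?_
    rw [← Finset.card_image_of_injective _ Fin.val_injective, ← Nat.card_Ico]
    refine Finset.card_le_card fun k hk => ?_
    obtain ⟨i, hi, rfl⟩ := Finset.mem_image.1 hk
    exact Finset.mem_Ico.2 ⟨(Finset.mem_filter.1 hi).2, i.2⟩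
  have hsub : (godanGraph n hn).neighborSet u ⊆ (u * ·) ''
      (({swap ⟨0, by omega⟩ ⟨1, by omega⟩, List.formPerm [⟨0, by omega⟩, ⟨1, by omega⟩,
        ⟨2, by omega⟩], List.formPerm [⟨0, by omega⟩, ⟨2, by omega⟩, ⟨1, by omega⟩]} ∪ R :
        Finset (Perm (Fin n))) : Set (Perm (Fin n))) := by
    intro v hv
    obtain ⟨s, hs, rfl⟩ := (godanGraph_adj n hn v u).1 (SimpleGraph.Adj.symm hv)
    refine ⟨s, ?_, rfl⟩
    rw [Finset.coe_union]
    refine hs.imp (fun h => by simpa using h) fun h => ?_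
    obtain ⟨i, hi, rfl⟩ := h
    exact Finset.mem_coe.2 (Finset.mem_image.2 ⟨i, by simpa using hi, rfl⟩)
  refine (Set.ncard_le_ncard hsub (Set.toFinite _)).trans
    ((Set.ncard_image_le (Set.toFinite _)).trans ?_)
  rw [Set.ncard_coe_finset]
  refine (Finset.card_union_le _ _).trans ?_
  refine (Nat.add_le_add Finset.card_le_three hRcard).trans ?_
  omega

/-- For `m = n` no position is prescribed, so the two signed cosets are the even and the odd
permutations, matched by right multiplication with (1 2). -/
theorem setPacking_godanGraph (hn : 3 ≤ n) {x y z : Perm (Fin n)} (hxy : x ≠ y) (hxz : x ≠ z)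
    (hyz : y ≠ z) : (godanGraph n hn).SetPacking {x, y, z} Set.univ (n - 1) := by
  set t : Perm (Fin n) := swap ⟨0, by omega⟩ ⟨1, by omega⟩ with ht
  have ht1 : sign t = -1 := sign_swap (by simp)
  have hmem : ∀ w u : Perm (Fin n), u ∈ signedCoset w n ↔ sign u = sign w := fun w u =>
    ⟨fun h => h.1, fun h => ⟨h, fun i hi => absurd i.2 (by omega)⟩⟩
  have huniv : ∀ u, u ∈ signedCoset (1 : Perm (Fin n)) n ∪ signedCoset t n := by
    intro u
    rw [Set.mem_union, hmem, hmem, ht1, Perm.sign_one]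
    exact Int.units_eq_one_or _
  refine ((wellConnected_signedCoset hn hn le_rfl 1).setPacking_of_matching
    (wellConnected_signedCoset hn hn le_rfl t) (by omega) ?_ (· * t) ?_ ?_ (mul_left_injective t)
    (fun u => godanGraph_adj_mul hn u (Or.inl (Or.inl rfl))) (huniv x) (huniv y) (huniv z)
    hxy hxz hyz).mono (Set.subset_univ _)
  · rw [Set.disjoint_left]
    intro u h1 h2
    rw [hmem] at h1 h2
    rw [h1, ht1, Perm.sign_one] at h2
    exact absurd h2 (by decide)
  · intro u hu
    rw [hmem] at hu ⊢
    rw [Perm.sign_mul, hu, Perm.sign_one, one_mul]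
  · intro u hu
    rw [hmem] at hu ⊢
    rw [Perm.sign_mul, hu, ht1, Perm.sign_one]
    rfl

end Godan

theorem theorem4p1 (n : ℕ) (hn : 3 ≤ n) :
    (godanGraph n hn).generalizedConnectivity 3 = ((n - 1 : ℕ) : ℕ∞) := by
  apply le_antisymm
  -- Any third vertex would do; `s` differs from the adjacent pair `1`, `t` because these fix the
  -- third position and `s` does not.
  · obtain ⟨s, -, hs, -⟩ :=
      exists_generator_apply_third hn (m := 3) le_rfl ⟨0, by omega⟩ (by simp)
    set t : Equiv.Perm (Fin n) := Equiv.swap ⟨0, by omega⟩ ⟨1, by omega⟩ with ht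
    have hadj : (godanGraph n hn).Adj 1 t := by
      simpa using godanGraph_adj_mul hn 1 (s := t) (Or.inl (Or.inl rfl))
    have hs1 : s ≠ 1 := by
      rintro rfl
      simp at hs
    have hst : s ≠ t := by
      intro hst
      rw [hst] at hs
      rw [ht, Equiv.swap_apply_of_ne_of_ne (by simp) (by simp)] at hs
      simp at hs
    have hle := SimpleGraph.treeConnectivity_le_of_adj hadj hs1 hst
      (ncard_neighborSet_godanGraph_le hn _) (ncard_neighborSet_godanGraph_le hn _)
    refine iInf₂_le_of_le {1, t, s}
      (Finset.card_eq_three.2 ⟨1, t, s, hadj.ne, hs1.symm, hst.symm, rfl⟩) ?_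
    simpa using hle
  · refine le_iInf₂ fun S hS => ?_
    obtain ⟨x, y, z, hxy, hxz, hyz, rfl⟩ := Finset.card_eq_three.1 hS
    refine SimpleGraph.SetPacking.le_treeConnectivity (U := Set.univ) ?_ ⟨x, by simp⟩
    simpa using setPacking_godanGraph hn hxy hxz hyz
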